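/- An $n$-permutation is a permutation $p=(p_1,\dots,p_n)$ of $\{1,\dots,n\}$, written in one-line notation. For a $k$-permutation $q=(q_1,\dots,q_k)$, we say that $p$ contains the pattern $q$ if there are positions $1\le i_1<i_2<\dots<i_k\le n$ such that, for all $a,b\in\{1,\dots,k\}$, $p_{i_a}<p_{i_b}$ if and only if $q_a<q_b$; otherwise $p$ avoids $q$. Let $S_n(q)$ be the number of $n$-permutations that avoid $q$. Then $S_n(1234)>0$ for every $n\ge 0$, and $$\lim_{n\to\infty}\frac{S_n(1342)}{S_n(1234)}=0 .$$ -/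

import Mathlib

namespace PatternAvoidance

/-- The `n`-permutation `p` (in one-line notation `p 0, p 1, …, p (n-1)`) contains the pattern `q`:
some subsequence of `p`, at positions `f 0 < f 1 < ⋯ < f (k-1)`, is in the same relative order
as the entries of `q`. -/
def Contains {n k : ℕ} (p : Equiv.Perm (Fin n)) (q : Equiv.Perm (Fin k)) : Prop :=
  ∃ f : Fin k → Fin n, StrictMono f ∧ ∀ a b : Fin k, q a < q b ↔ p (f a) < p (f b)

/-- The permutation `p` avoids the pattern `q`. -/
def Avoids {n k : ℕ} (p : Equiv.Perm (Fin n)) (q : Equiv.Perm (Fin k)) : Prop :=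
  ¬ Contains p q

/-- `S n q` is the number of `n`-permutations that avoid the pattern `q`. -/
noncomputable def S (n : ℕ) {k : ℕ} (q : Equiv.Perm (Fin k)) : ℕ :=
  Nat.card {p : Equiv.Perm (Fin n) // Avoids p q}

/-- The pattern `1342` (positions and values are counted from `0`). -/
def pattern1342 : Equiv.Perm (Fin 4) where
  toFun := ![0, 2, 3, 1]
  invFun := ![0, 3, 1, 2]
  left_inv := by decide
  right_inv := by decide

/-- The increasing pattern `1234` (positions and values are counted from `0`). -/
def pattern1234 : Equiv.Perm (Fin 4) where
  toFun := ![0, 1, 2, 3]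
  invFun := ![0, 1, 2, 3]
  left_inv := by decide
  right_inv := by decide

end PatternAvoidance

/-!
The numbers `S n 1342` grow like `8 ^ n` and the numbers `S n 1234` like `9 ^ n`. It is enough to
show `S n 1342 ≤ (32 / 27) * 8 ^ n` and `S n 1234 ≥ c * (81 / 10) ^ n`.

*Upper bound.* Write a `1342`-avoiding word as `L M R` with `M` its maximum. The values of `R` cut
the line into gaps, and avoidance forces the entries of `L` to occur block by block, from the top
gap to the bottom one: otherwise two entries of `L`, `M` and a separating entry of `R` form a `1342`. Moreover the entries of `R` above any entry of `L` avoid `231`. With `T` the number of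
high entries (the largest upper set of values on which the word avoids `231`, `highCount`), the
blocks occupy the topmost `T(R) + 1` gaps, and if the topmost nonempty block `B` lies in the
`i`-th gap, then `T(L M R) = 1 + i + T(B)` (`Split.highCount_eq`). The word is recovered from the
order types of `R` and of the blocks (`Split.eq_of_std_eq`). So the generating function
`A(u) = ∑ x ^ |l| * u ^ T(l)`, with `a = A(1)`, is bounded by any nonnegative solution of
`A(u) = 1 + x u A(u) + x u (A(u) - 1) (u A(u) - a A(a)) / (u - a)`.
At `x = 1 / 8` there is an explicit one: in the variable `w = 3 u / 16` it is
`(4 C - C ^ 2) / 3` with `C` the Catalan series, and `a = 32 / 27`. Its coefficients are `phi`,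
the coefficients of the difference quotient are `psi`, and `phi_succ` is the functional equation.
Induction on the length (`weightSum_succ_le`) bounds every coefficient of the generating function,
hence its value at `u = 1`.

*Lower bound.* A permutation that is the union of three decreasing sequences avoids `1234`, and it
is given by a pair of ternary words with the same content, colouring its positions and its values.
The colouring can be read off from the permutation if it is greedy (`IsGreedy.unique`), and it is
greedy if before every letter `k + 1` the letter `k` is more frequent in the first word than it
can be in the second one (`exists_isGreedy`). Taking concatenations of balanced blocks of `90`
letters for both words, with a head start of bounded length, satisfies this
(`pow_le_card_avoids1234`), and the number of such blocks is a trinomial coefficient whose square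
exceeds `8.1 ^ 90`.
-/

namespace PatternAvoidance

open Finset

/-! ### Numerical weights built from Catalan numbers -/

lemma sum_le_sum_of_injOn {ι κ : Type*} {s : Finset ι} {t : Finset κ} {f : ι → ℝ} {g : κ → ℝ}
    (e : ι → κ) (he : ∀ i ∈ s, e i ∈ t) (hinj : Set.InjOn e s) (hfg : ∀ i ∈ s, f i ≤ g (e i))
    (hg : ∀ k ∈ t, 0 ≤ g k) : ∑ i ∈ s, f i ≤ ∑ k ∈ t, g k := by
  classical
  calc ∑ i ∈ s, f i ≤ ∑ i ∈ s, g (e i) := Finset.sum_le_sum hfg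
    _ = ∑ k ∈ s.image e, g k := (Finset.sum_image hinj).symm
    _ ≤ ∑ k ∈ t, g k := by
      refine Finset.sum_le_sum_of_subset_of_nonneg ?_ fun k hk _ => hg k hk
      intro k hk
      obtain ⟨i, hi, rfl⟩ := Finset.mem_image.1 hk
      exact he i hi

lemma catalan_succ_mul_pow (y : ℝ) (n : ℕ) : (catalan (n + 1) : ℝ) * y ^ (n + 1) =
    y * ∑ ij ∈ HasAntidiagonal.antidiagonal n,
      ((catalan ij.1 : ℝ) * y ^ ij.1) * ((catalan ij.2 : ℝ) * y ^ ij.2) := by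
  rw [catalan_succ']
  push_cast
  rw [Finset.sum_mul, Finset.mul_sum]
  refine Finset.sum_congr rfl fun ij hij => ?_
  rw [HasAntidiagonal.mem_antidiagonal] at hij
  rw [← hij]
  ring

lemma sum_catalan_mul_pow_succ_le (y : ℝ) (hy : 0 ≤ y) (N : ℕ) :
    ∑ k ∈ range (N + 1), (catalan k : ℝ) * y ^ k ≤
      1 + y * (∑ k ∈ range N, (catalan k : ℝ) * y ^ k) ^ 2 := by
  rw [Finset.sum_range_succ']
  simp only [catalan_succ_mul_pow, catalan_zero]
  rw [← Finset.mul_sum]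
  have h2 : ∑ n ∈ range N, ∑ ij ∈ HasAntidiagonal.antidiagonal n,
      ((catalan ij.1 : ℝ) * y ^ ij.1) * ((catalan ij.2 : ℝ) * y ^ ij.2) ≤
      (∑ k ∈ range N, (catalan k : ℝ) * y ^ k) ^ 2 := by
    rw [sq, Finset.sum_mul_sum, ← Finset.sum_product', Finset.sum_sigma']
    refine sum_le_sum_of_injOn (fun s => s.2) ?_ ?_ (fun _ _ => le_rfl) (fun _ _ => by positivity)
    · rintro ⟨n, i, j⟩ h
      simp only [mem_sigma, mem_range, HasAntidiagonal.mem_antidiagonal] at h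
      simp only [mem_product, mem_range]
      omega
    · rintro ⟨n, i, j⟩ h ⟨n', i', j'⟩ h' he
      simp only [coe_sigma, Set.mem_sigma_iff, mem_coe, HasAntidiagonal.mem_antidiagonal] at h h'
      simp only [Prod.mk.injEq] at he
      obtain ⟨rfl, rfl⟩ := he
      obtain rfl : n = n' := by rw [← h.2, ← h'.2]
      rfl
  have h3 := mul_le_mul_of_nonneg_left h2 hy
  push_cast
  rw [pow_zero, mul_one, add_comm]
  linarith

/-- The Catalan series sums to the branch `z < 2` of `z = 1 + y z ^ 2`. -/
lemma hasSum_catalan (y z : ℝ) (hz : 1 ≤ z) (hz2 : z < 2) (hyz : z = 1 + y * z ^ 2) :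
    HasSum (fun k => (catalan k : ℝ) * y ^ k) z := by
  have hy : 0 ≤ y := by
    by_contra h
    nlinarith [mul_pos (neg_pos.2 (not_le.1 h)) (show 0 < z ^ 2 by positivity)]
  have h0 : ∀ k, 0 ≤ (catalan k : ℝ) * y ^ k := fun k => by positivity
  have hle : ∀ N, ∑ k ∈ range N, (catalan k : ℝ) * y ^ k ≤ z := by
    intro N
    induction N with
    | zero => simp; linarith
    | succ N ih =>
      refine (sum_catalan_mul_pow_succ_le y hy N).trans ?_
      have h1 : (∑ k ∈ range N, (catalan k : ℝ) * y ^ k) ^ 2 ≤ z ^ 2 :=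
        pow_le_pow_left₀ (Finset.sum_nonneg fun k _ => h0 k) ih 2
      nlinarith [mul_le_mul_of_nonneg_left h1 hy]
  have hs : Summable (fun k => (catalan k : ℝ) * y ^ k) := summable_of_sum_range_le h0 hle
  have hL : ∑' k, (catalan k : ℝ) * y ^ k ≤ z := hs.tsum_le_of_sum_range_le hle
  have hL0 : 0 ≤ ∑' k, (catalan k : ℝ) * y ^ k := tsum_nonneg h0
  have hn : Summable (fun k => ‖(catalan k : ℝ) * y ^ k‖) := hs.norm
  have heq : ∑' k, (catalan k : ℝ) * y ^ k = 1 + y * (∑' k, (catalan k : ℝ) * y ^ k) ^ 2 := by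
    conv_lhs => rw [hs.tsum_eq_zero_add]
    simp only [catalan_succ_mul_pow, catalan_zero]
    rw [tsum_mul_left, sq, tsum_mul_tsum_eq_tsum_sum_antidiagonal_of_summable_norm hn hn]
    simp
  have hval : ∑' k, (catalan k : ℝ) * y ^ k = z := by
    set L := ∑' k, (catalan k : ℝ) * y ^ k
    have h1 : (L - z) * (y * (L + z) - 1) = 0 := by linear_combination hyz - heq
    rcases mul_eq_zero.1 h1 with h | h
    · linarith
    · exfalso
      -- `y (L + z) ≤ 2 y z = 2 (z - 1) / z < 1`
      have h2 : y * (L + z) ≤ y * (z + z) := by gcongr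
      nlinarith
  rw [← hval]
  exact hs.hasSum

/-- The coefficients of `(4 C - C ^ 2) / 3`, where `C` is the Catalan series. -/
noncomputable def catalanWeight (n : ℕ) : ℝ := (4 * catalan n - catalan (n + 1)) / 3

lemma catalanWeight_nonneg (n : ℕ) : 0 ≤ catalanWeight n := by
  have h1 := succ_mul_catalan_eq_centralBinom n
  have h2 := succ_mul_catalan_eq_centralBinom (n + 1)
  have h3 := Nat.succ_mul_centralBinom_succ n
  have h4 : catalan (n + 1) ≤ 4 * catalan n := by
    rw [← h1, ← h2] at h3
    have h5 : (n + 1) * ((n + 2) * catalan (n + 1)) = (n + 1) * (2 * (2 * n + 1) * catalan n) := by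
      linarith
    have h6 := Nat.eq_of_mul_eq_mul_left (Nat.succ_pos n) h5
    by_contra h
    push Not at h
    nlinarith
  have h5 : (catalan (n + 1) : ℝ) ≤ 4 * catalan n := by exact_mod_cast h4
  unfold catalanWeight
  linarith

lemma catalanWeight_zero : catalanWeight 0 = 1 := by
  norm_num [catalanWeight]

lemma hasSum_catalanWeight (y z : ℝ) (hy : y ≠ 0) (hz : 1 ≤ z) (hz2 : z < 2)
    (hyz : z = 1 + y * z ^ 2) :
    HasSum (fun k => catalanWeight k * y ^ k) ((4 * z - z ^ 2) / 3) := by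
  have h := hasSum_catalan y z hz hz2 hyz
  have h1 : HasSum (fun k => (catalan (k + 1) : ℝ) * y ^ (k + 1)) (z - 1) := by
    rw [hasSum_nat_add_iff' (f := fun k => (catalan k : ℝ) * y ^ k) 1 |>.symm] at h
    simpa using h
  have h2 := ((h.mul_left 4).sub (h1.div_const y)).div_const 3
  have h3 : (z - 1) / y = z ^ 2 := by rw [div_eq_iff hy]; linarith
  rw [h3] at h2
  have h4 : (fun k => catalanWeight k * y ^ k) = fun k =>
      (4 * ((catalan k : ℝ) * y ^ k) - (catalan (k + 1) : ℝ) * y ^ (k + 1) / y) / 3 := by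
    funext k
    unfold catalanWeight
    field_simp
    ring
  rw [h4]
  exact h2

/-- The weight `φ t` bounding the generating function, at `x = 1/8`, of the `1342`-avoiding words
whose statistic equals `t`. -/
noncomputable def phi (t : ℕ) : ℝ := catalanWeight t * (3 / 16) ^ t

lemma phi_nonneg (t : ℕ) : 0 ≤ phi t := mul_nonneg (catalanWeight_nonneg t) (by positivity)

lemma phi_zero : phi 0 = 1 := by simp [phi, catalanWeight_zero]

lemma sum_phi_le (s : Finset ℕ) : ∑ t ∈ s, phi t ≤ 32 / 27 := by
  have h := hasSum_catalanWeight (3 / 16) (4 / 3) (by norm_num) (by norm_num) (by norm_num)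
    (by norm_num)
  have h2 := sum_le_hasSum s (fun i _ => phi_nonneg i) h
  refine h2.trans (by norm_num)

lemma hasSum_phi : HasSum (fun k => phi k * (32 / 27) ^ k) (5 / 4) := by
  have h := hasSum_catalanWeight (2 / 9) (3 / 2) (by norm_num) (by norm_num) (by norm_num)
    (by norm_num)
  convert h using 1
  · ext k
    rw [phi, mul_assoc, ← mul_pow]
    norm_num
  · norm_num

/-- The tails `∑ₖ φ (i + k) α ^ k`, `α = 32 / 27`. -/
noncomputable def psi (i : ℕ) : ℝ := ∑' k, phi (i + k) * (32 / 27) ^ k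

lemma psi_zero : psi 0 = 5 / 4 := by
  simpa [psi] using hasSum_phi.tsum_eq

lemma summable_psi (i : ℕ) : Summable (fun k => phi (i + k) * (32 / 27 : ℝ) ^ k) := by
  have h := (summable_nat_add_iff i).2 hasSum_phi.summable
  have h2 := h.mul_right (((32 / 27 : ℝ) ^ i)⁻¹)
  refine h2.congr fun k => ?_
  rw [pow_add, add_comm k i]
  field_simp

lemma sum_phi_mul_pow_le_psi (i : ℕ) (s : Finset ℕ) :
    ∑ k ∈ s, phi (i + k) * (32 / 27) ^ k ≤ psi i :=
  (summable_psi i).sum_le_tsum s fun k _ => mul_nonneg (phi_nonneg _) (by positivity)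

lemma psi_eq (i : ℕ) : psi i = phi i + 32 / 27 * psi (i + 1) := by
  rw [psi, (summable_psi i).tsum_eq_zero_add, psi, ← tsum_mul_left]
  simp only [add_zero, pow_zero, mul_one]
  congr 2
  ext k
  rw [show i + (k + 1) = i + 1 + k by ring]
  ring

open PowerSeries in
/-- The recursion satisfied by `φ`: it is the functional equation of the generating function,
checked in the power series ring on the explicit solution. -/
lemma phi_succ (n : ℕ) : phi (n + 1) = 1 / 8 * (phi n +
    ∑ ij ∈ (HasAntidiagonal.antidiagonal n).filter (fun ij => 1 ≤ ij.2),
      psi ij.1 * phi ij.2) := by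
  -- After rescaling by `16 / 3`, all series are algebraic over the Catalan series.
  set A : PowerSeries ℝ := (catalanSeries).map (Nat.castRingHom ℝ) with hA
  set F : PowerSeries ℝ := PowerSeries.mk catalanWeight with hF
  set H : PowerSeries ℝ := PowerSeries.mk (fun i => psi i * (16 / 3) ^ i) with hH
  have hA1 : A ^ 2 * X + 1 = A := by
    have h := congrArg (PowerSeries.map (Nat.castRingHom ℝ)) catalanSeries_sq_mul_X_add_one
    simpa using h
  have hA2 : A ^ 2 = PowerSeries.mk (fun n => (catalan (n + 1) : ℝ)) := by
    ext n
    have h := congrArg (PowerSeries.coeff (n + 1)) hA1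
    simp only [map_add, coeff_succ_mul_X, PowerSeries.coeff_one] at h
    simp [hA] at h
    simp [hA, h]
  have hF1 : 3 * F = 4 * A - A ^ 2 := by
    rw [hA2]
    ext n
    rw [show (3 : PowerSeries ℝ) = PowerSeries.C (3 : ℝ) from rfl,
      show (4 : PowerSeries ℝ) = PowerSeries.C (4 : ℝ) from rfl]
    simp only [map_sub, PowerSeries.coeff_C_mul, hF, hA, PowerSeries.coeff_mk,
      PowerSeries.coeff_map, catalanSeries_coeff, catalanWeight]
    simp
    ring
  have hH1 : (18 * X - 4) * H = 18 * X * F - 5 := by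
    rw [show (18 : PowerSeries ℝ) = PowerSeries.C (18 : ℝ) from rfl,
      show (4 : PowerSeries ℝ) = PowerSeries.C (4 : ℝ) from rfl,
      show (5 : PowerSeries ℝ) = PowerSeries.C (5 : ℝ) from rfl, sub_mul, mul_assoc, mul_assoc]
    ext n
    rcases n with _ | n
    · simp [hH, psi_zero]
      norm_num
    · simp only [map_sub, PowerSeries.coeff_C_mul, PowerSeries.coeff_succ_X_mul, hF, hH,
        PowerSeries.coeff_mk, PowerSeries.coeff_C, Nat.succ_ne_zero, if_false]
      rw [psi_eq n, phi, add_mul, mul_assoc (catalanWeight n), ← mul_pow]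
      norm_num
      ring
  have hG : 3 + 2 * X * (F + H * (F - 1)) - 3 * F = 0 := by
    have hX : (18 * X - 4 : PowerSeries ℝ) ≠ 0 := by
      intro h
      have h2 := congrArg (PowerSeries.constantCoeff) h
      rw [show (4 : PowerSeries ℝ) = PowerSeries.C (4 : ℝ) from rfl] at h2
      simp at h2
    have h9 : (9 : PowerSeries ℝ) ≠ 0 := by
      intro h
      have h2 := congrArg (PowerSeries.constantCoeff) h
      rw [show (9 : PowerSeries ℝ) = PowerSeries.C (9 : ℝ) from rfl] at h2
      simp at h2
    have h : 9 * ((18 * X - 4) * (3 + 2 * X * (F + H * (F - 1)) - 3 * F)) = 0 := by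
      have e1 : 9 * ((18 * X - 4) * (3 + 2 * X * (F + H * (F - 1)) - 3 * F)) =
          (18 * X - 4) * (27 + 6 * X * (3 * F) - 9 * (3 * F)) +
          2 * X * (6 * X * (3 * F) - 5) * (3 * (3 * F) - 9) := by
        linear_combination 9 * 2 * X * (F - 1) * hH1
      rw [e1, hF1]
      linear_combination (36 * X * A ^ 2 - 288 * X * A + 576 * X + 36 * A - 108) * hA1
    exact (mul_eq_zero.1 ((mul_eq_zero.1 h).resolve_left h9)).resolve_left hX
  have hG' : PowerSeries.C 3 + PowerSeries.C 2 * (X * (F + H * F - H)) - PowerSeries.C 3 * F =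
      (0 : PowerSeries ℝ) := by
    rw [← hG, show (3 : PowerSeries ℝ) = PowerSeries.C (3 : ℝ) from rfl,
      show (2 : PowerSeries ℝ) = PowerSeries.C (2 : ℝ) from rfl]
    ring
  have h := congrArg (PowerSeries.coeff (n + 1)) hG'
  simp only [map_sub, map_add, PowerSeries.coeff_C_mul, PowerSeries.coeff_succ_X_mul,
    PowerSeries.coeff_C, Nat.succ_ne_zero, if_false, map_zero] at h
  simp only [hF, hH, PowerSeries.coeff_mk, PowerSeries.coeff_mul] at h
  have hsplit : (HasAntidiagonal.antidiagonal n).filter (fun ij => ¬ 1 ≤ ij.2) = {(n, 0)} := by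
    ext ⟨i, j⟩
    simp only [mem_filter, HasAntidiagonal.mem_antidiagonal, mem_singleton, Prod.mk.injEq]
    omega
  have hsum : ∑ ij ∈ HasAntidiagonal.antidiagonal n, psi ij.1 * (16 / 3) ^ ij.1 *
      catalanWeight ij.2 - psi n * (16 / 3) ^ n =
      (∑ ij ∈ (HasAntidiagonal.antidiagonal n).filter (fun ij => 1 ≤ ij.2),
        psi ij.1 * phi ij.2) * (16 / 3) ^ n := by
    rw [← Finset.sum_filter_add_sum_filter_not _ (fun ij : ℕ × ℕ => 1 ≤ ij.2), hsplit,
      Finset.sum_singleton, catalanWeight_zero, mul_one, add_sub_cancel_right, Finset.sum_mul]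
    refine Finset.sum_congr rfl fun ij hij => ?_
    have hij' := (mem_filter.1 hij).1
    rw [HasAntidiagonal.mem_antidiagonal] at hij'
    rw [← hij', pow_add, phi]
    have h1 : ((3 : ℝ) / 16) ^ ij.2 * (16 / 3) ^ ij.2 = 1 := by
      rw [← mul_pow]
      norm_num
    linear_combination (- psi ij.1 * catalanWeight ij.2 * (16 / 3) ^ ij.1) * h1
  have h1 : ((3 : ℝ) / 16) ^ n * (16 / 3) ^ n = 1 := by
    rw [← mul_pow]
    norm_num
  set Q := ∑ ij ∈ (HasAntidiagonal.antidiagonal n).filter (fun ij => 1 ≤ ij.2),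
        psi ij.1 * phi ij.2
  have h2 : catalanWeight (n + 1) = 2 / 3 * (catalanWeight n + Q * (16 / 3) ^ n) := by
    rw [← hsum]
    linarith
  rw [phi, phi, h2, pow_succ]
  linear_combination (1 / 8 * Q) * h1

end PatternAvoidance

namespace PatternAvoidance

/-! ### Words avoiding `1342`, and standardization -/

/-- A word of natural numbers avoids the pattern `1342`. -/
def Avoids1342 (l : List ℕ) : Prop :=
  ∀ a b c d, [a, b, c, d].Sublist l → ¬ (a < d ∧ d < b ∧ b < c)

/-- `a` plays the role of the `1` in an occurrence of the pattern `231` in `l`. -/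
def IsLow231 (l : List ℕ) (a : ℕ) : Prop :=
  ∃ b c, [b, c, a].Sublist l ∧ a < b ∧ b < c

/-- An entry is high if it exceeds the smallest letter of every occurrence of `231`; the high
entries are the largest upper set of values on which the word avoids `231`. -/
def IsHigh (l : List ℕ) (x : ℕ) : Prop := ∀ a, IsLow231 l a → a < x

open Classical in
/-- The number of high entries of a word. -/
noncomputable def highCount (l : List ℕ) : ℕ := l.countP (fun x => decide (IsHigh l x))

/-- Replace each entry by the number of smaller entries. -/
def std (l : List ℕ) : List ℕ := l.map fun x => l.countP (· < x)

lemma Avoids1342.sublist {l l' : List ℕ} (h : Avoids1342 l) (hl : l'.Sublist l) :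
    Avoids1342 l' := fun a b c d h' => h a b c d (h'.trans hl)

lemma IsLow231.sublist {l l' : List ℕ} {a : ℕ} (h : IsLow231 l' a) (hl : l'.Sublist l) :
    IsLow231 l a := by
  obtain ⟨b, c, h1, h2⟩ := h
  exact ⟨b, c, h1.trans hl, h2⟩

lemma IsLow231.mem {l : List ℕ} {a : ℕ} (h : IsLow231 l a) : a ∈ l := by
  obtain ⟨b, c, h1, -⟩ := h
  exact h1.subset (by simp)

lemma Avoids1342.map {l : List ℕ} {f : ℕ → ℕ} (hf : ∀ x ∈ l, ∀ y ∈ l, f x < f y ↔ x < y)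
    (h : Avoids1342 l) : Avoids1342 (l.map f) := by
  intro a b c d hs
  obtain ⟨l', hl', he⟩ := List.sublist_map_iff.1 hs
  match l', he with
  | [a', b', c', d'], he =>
    simp only [List.map_cons, List.map_nil, List.cons.injEq, and_true] at he
    obtain ⟨rfl, rfl, rfl, rfl⟩ := he
    have ha : a' ∈ l := hl'.subset (by simp)
    have hb : b' ∈ l := hl'.subset (by simp)
    have hc : c' ∈ l := hl'.subset (by simp)
    have hd : d' ∈ l := hl'.subset (by simp)
    rw [hf _ ha _ hd, hf _ hd _ hb, hf _ hb _ hc]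
    exact h _ _ _ _ hl'

lemma isLow231_map_iff {l : List ℕ} {f : ℕ → ℕ} (hf : ∀ x ∈ l, ∀ y ∈ l, f x < f y ↔ x < y)
    (z : ℕ) : IsLow231 (l.map f) z ↔ ∃ a, IsLow231 l a ∧ f a = z := by
  constructor
  · rintro ⟨b, c, hs, h1, h2⟩
    obtain ⟨l', hl', he⟩ := List.sublist_map_iff.1 hs
    match l', he with
    | [b', c', a'], he =>
      simp only [List.map_cons, List.map_nil, List.cons.injEq, and_true] at he
      obtain ⟨rfl, rfl, rfl⟩ := he
      have ha : a' ∈ l := hl'.subset (by simp)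
      have hb : b' ∈ l := hl'.subset (by simp)
      have hc : c' ∈ l := hl'.subset (by simp)
      rw [hf _ ha _ hb] at h1
      rw [hf _ hb _ hc] at h2
      exact ⟨a', ⟨b', c', hl', h1, h2⟩, rfl⟩
  · rintro ⟨a, ⟨b, c, hs, h1, h2⟩, rfl⟩
    have ha : a ∈ l := hs.subset (by simp)
    have hb : b ∈ l := hs.subset (by simp)
    have hc : c ∈ l := hs.subset (by simp)
    exact ⟨f b, f c, by simpa using hs.map f, (hf _ ha _ hb).2 h1, (hf _ hb _ hc).2 h2⟩

lemma highCount_map {l : List ℕ} {f : ℕ → ℕ} (hf : ∀ x ∈ l, ∀ y ∈ l, f x < f y ↔ x < y) :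
    highCount (l.map f) = highCount l := by
  unfold highCount
  rw [List.countP_map]
  refine List.countP_congr fun x hx => ?_
  simp only [Function.comp, decide_eq_true_eq]
  unfold IsHigh
  simp only [isLow231_map_iff hf]
  constructor
  · intro h a ha
    exact (hf _ ha.mem _ hx).1 (h _ ⟨a, ha, rfl⟩)
  · rintro h _ ⟨a, ha, rfl⟩
    exact (hf _ ha.mem _ hx).2 (h a ha)

lemma highCount_le_length (l : List ℕ) : highCount l ≤ l.length := List.countP_le_length

lemma countP_lt_countP_of_imp {l : List ℕ} {p q : ℕ → Bool} (h : ∀ x ∈ l, p x = true → q x = true)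
    (x : ℕ) (hx : x ∈ l) (hq : q x = true) (hp : p x = false) : l.countP p < l.countP q := by
  obtain ⟨s, t, rfl⟩ := List.append_of_mem hx
  rw [List.countP_append, List.countP_append, List.countP_cons, List.countP_cons, hq, hp]
  have h1 : s.countP p ≤ s.countP q := List.countP_mono_left fun y hy => h y (by simp [hy])
  have h2 : t.countP p ≤ t.countP q := List.countP_mono_left fun y hy => h y (by simp [hy])
  simp
  omega

lemma countP_lt_lt_iff (l : List ℕ) : ∀ x ∈ l, ∀ y ∈ l,
    l.countP (· < x) < l.countP (· < y) ↔ x < y := by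
  intro x hx y _
  constructor
  · intro h
    by_contra hxy
    refine absurd h (not_lt.2 (List.countP_mono_left fun z _ hz => ?_))
    simp only [decide_eq_true_eq] at hz ⊢
    omega
  · intro h
    refine countP_lt_countP_of_imp (fun z _ hz => ?_) x hx (by simpa using h) (by simp)
    simp only [decide_eq_true_eq] at hz ⊢
    omega

lemma length_std (l : List ℕ) : (std l).length = l.length := by simp [std]

lemma Avoids1342.std {l : List ℕ} (h : Avoids1342 l) : Avoids1342 (std l) :=
  h.map (countP_lt_lt_iff l)

lemma highCount_std (l : List ℕ) : highCount (std l) = highCount l :=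
  highCount_map (countP_lt_lt_iff l)

lemma std_perm_range {l : List ℕ} (h : l.Nodup) : (std l).Perm (List.range l.length) := by
  have hn : (std l).Nodup := by
    refine h.map_on fun x hx y hy he => ?_
    have h1 := countP_lt_lt_iff l x hx y hy
    have h2 := countP_lt_lt_iff l y hy x hx
    omega
  refine (List.subperm_of_subset hn ?_).perm_of_length_le (by simp [length_std])
  intro z hz
  obtain ⟨x, hx, rfl⟩ := List.mem_map.1 hz
  rw [List.mem_range, List.countP_lt_length_iff]
  exact ⟨x, hx, by simp⟩

lemma countP_lt_range {n x : ℕ} (h : x ≤ n) : (List.range n).countP (· < x) = x := by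
  have h1 : (List.range n).countP (· < x) = ((Finset.range n).filter (· < x)).card := by
    rw [List.countP_eq_length_filter]
    rfl
  rw [h1, show (Finset.range n).filter (· < x) = Finset.range x by ext; simp; omega,
    Finset.card_range]

lemma countP_lt_of_perm_range {l : List ℕ} {n x : ℕ} (h : l.Perm (List.range n)) (hx : x ∈ l) :
    l.countP (· < x) = x := by
  rw [h.countP_eq, countP_lt_range]
  exact (List.mem_range.1 (h.subset hx)).le

/-! ### Splitting a word at its maximum -/

/-- The number of entries of `R` above `x`. -/
def above (R : List ℕ) (x : ℕ) : ℕ := R.countP (x < ·)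

lemma lt_of_above_lt {R : List ℕ} {x y : ℕ} (h : above R y < above R x) : x < y := by
  by_contra hxy
  refine absurd h (not_lt.2 (List.countP_mono_left fun z _ hz => ?_))
  simp only [decide_eq_true_eq] at hz ⊢
  omega

lemma above_lt_above {R : List ℕ} {x y r : ℕ} (hr : r ∈ R) (hx : x < r) (hy : r ≤ y) :
    above R y < above R x := by
  refine countP_lt_countP_of_imp (fun z _ hz => ?_) r hr (by simpa using hx) (by simpa using hy)
  simp only [decide_eq_true_eq] at hz ⊢
  omega

lemma exists_between_of_above_lt {R : List ℕ} {x y : ℕ} (h : above R y < above R x) :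
    ∃ r ∈ R, x < r ∧ r ≤ y := by
  by_contra hc
  push Not at hc
  refine absurd h (not_lt.2 (List.countP_mono_left fun z hz hz' => ?_))
  simp only [decide_eq_true_eq] at hz' ⊢
  exact hc z hz hz'

/-- The word `L ++ M :: R` has distinct entries, with maximum `M`, and avoids `1342`. -/
structure Split (L R : List ℕ) (M : ℕ) : Prop where
  nodup : (L ++ M :: R).Nodup
  lt_left : ∀ x ∈ L, x < M
  lt_right : ∀ x ∈ R, x < M
  avoids : Avoids1342 (L ++ M :: R)

namespace Split

variable {L R : List ℕ} {M : ℕ}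

lemma ne (h : Split L R M) {x y : ℕ} (hx : x ∈ L) (hy : y ∈ R) : x ≠ y :=
  (List.nodup_append.1 h.nodup).2.2 x hx y (by simp [hy])

/-- An entry `x` on the left of the maximum may not precede a `231` on its right lying above `x`. -/
lemma lt_of_isLow231 (h : Split L R M) {x a : ℕ} (hx : x ∈ L) (ha : IsLow231 R a) : a < x := by
  obtain ⟨b, c, h1, h2, h3⟩ := id ha
  by_contra hax
  have h4 : x < a := lt_of_le_of_ne (not_lt.1 hax) (h.ne hx ha.mem)
  refine h.avoids x b c a ?_ ⟨h4, h2, h3⟩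
  exact (List.singleton_sublist.2 hx).append (h1.trans (List.sublist_cons_self _ _))

/-- The entries left of the maximum occur in decreasing order of the gaps, between the values to
the right of the maximum, in which they lie. -/
lemma pairwise_above (h : Split L R M) : L.Pairwise (fun x y => above R x ≤ above R y) := by
  rw [List.pairwise_iff_forall_sublist]
  intro x y hxy
  by_contra hlt
  obtain ⟨r, hr, h1, h2⟩ := exists_between_of_above_lt (not_le.1 hlt)
  have hy : y ∈ L := hxy.subset (by simp)
  refine h.avoids x y M r ?_ ⟨h1, lt_of_le_of_ne h2 (h.ne hy hr).symm, h.lt_left y hy⟩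
  exact hxy.append ((List.singleton_sublist.2 hr).cons_cons M)

/-- All of `R` above an entry `x` of `L` is high, so `x` lies in one of the
`highCount R + 1` topmost gaps. -/
lemma above_le_highCount (h : Split L R M) {x : ℕ} (hx : x ∈ L) : above R x ≤ highCount R := by
  refine List.countP_mono_left fun z _ hz => ?_
  simp only [decide_eq_true_eq] at hz ⊢
  exact fun a ha => (h.lt_of_isLow231 hx ha).trans hz

/-- Apart from the occurrences of `231` inside `L` and inside `R`, those that matter use the maximum
as their largest letter. -/
lemma isLow231_iff (h : Split L R M) (a : ℕ) : IsLow231 (L ++ M :: R) a ↔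
    IsLow231 L a ∨ (a ∈ R ∧ ∃ b ∈ L, a < b) ∨ IsLow231 R a := by
  constructor
  · rintro ⟨b, c, hs, h1, h2⟩
    obtain ⟨l₁, l₂, he, hl₁, hl₂⟩ := List.sublist_append_iff.1 hs
    match l₁, he with
    | [], he =>
      simp only [List.nil_append] at he
      subst he
      rcases List.sublist_cons_iff.1 hl₂ with h3 | ⟨r, h3, h4⟩
      · exact Or.inr (Or.inr ⟨b, c, h3, h1, h2⟩)
      · simp only [List.cons.injEq] at h3
        obtain ⟨rfl, rfl⟩ := h3
        exact absurd (h.lt_right c (h4.subset (by simp))) (by omega)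
    | b' :: l₁', he =>
      simp only [List.cons_append, List.cons.injEq] at he
      obtain ⟨rfl, he⟩ := he
      have hb : b ∈ L := hl₁.subset (by simp)
      by_cases haR : a ∈ l₂
      · have h3 := hl₂.subset haR
        have := h.lt_left b hb
        rw [List.mem_cons] at h3
        exact Or.inr (Or.inl ⟨h3.resolve_left (by omega), b, hb, h1⟩)
      · have h3 : l₂ = [] := by
          rcases List.eq_nil_or_concat l₂ with h4 | ⟨l₃, z, rfl⟩
          · exact h4
          · exfalso
            have h5 := congrArg List.getLast? he
            simp at h5
            exact haR (by simp [h5])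
        subst h3
        rw [List.append_nil] at he
        subst he
        exact Or.inl ⟨b, c, hl₁, h1, h2⟩
  · rintro (h1 | ⟨h1, b, hb, h2⟩ | h1)
    · exact h1.sublist (List.sublist_append_left _ _)
    · exact ⟨b, M, (List.singleton_sublist.2 hb).append ((List.singleton_sublist.2 h1).cons_cons M),
        h2, h.lt_left b hb⟩
    · exact h1.sublist ((List.sublist_cons_self _ _).trans (List.sublist_append_right _ _))

lemma isHigh_max (h : Split L R M) : IsHigh (L ++ M :: R) M := by
  intro a ha
  rcases (h.isLow231_iff a).1 ha with h1 | h1 | h1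
  · exact h.lt_left a h1.mem
  · exact h.lt_right a h1.1
  · exact h.lt_right a h1.mem

lemma highCount_nil (h : Split [] R M) : highCount ([] ++ M :: R) = 1 + highCount R := by
  classical
  unfold highCount
  rw [List.countP_append, List.countP_cons, List.countP_nil, if_pos (by simpa using h.isHigh_max)]
  have : List.countP (fun x => decide (IsHigh ([] ++ M :: R) x)) R =
      List.countP (fun x => decide (IsHigh R x)) R := by
    refine List.countP_congr fun x _ => ?_
    simp only [decide_eq_true_eq]
    unfold IsHigh
    simp only [h.isLow231_iff]
    constructor
    · exact fun h1 a ha => h1 a (Or.inr (Or.inr ha))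
    · rintro h1 a (⟨_, _, ha, -⟩ | ⟨-, b, hb, -⟩ | ha)
      · simp at ha
      · simp at hb
      · exact h1 a ha
  rw [this]
  omega

/-- If some entry precedes the maximum, the high entries are the maximum, the `i` entries on its
right that exceed everything on its left, and the high entries of the topmost nonempty block on its
left. -/
lemma highCount_eq (h : Split L R M) {i : ℕ} (hi : ∀ x ∈ L, i ≤ above R x) {x₀ : ℕ} (hx₀ : x₀ ∈ L)
    (hx₀i : above R x₀ = i) :
    highCount (L ++ M :: R) = 1 + i + highCount (L.filter (above R · = i)) := by
  classical
  have hR : List.countP (fun x => decide (IsHigh (L ++ M :: R) x)) R = i := by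
    rw [← hx₀i]
    refine List.countP_congr fun y hy => ?_
    simp only [decide_eq_true_eq]
    constructor
    · intro h1
      by_contra h2
      have h3 : y < x₀ := lt_of_le_of_ne (not_lt.1 h2) (h.ne hx₀ hy).symm
      exact lt_irrefl _ (h1 y ((h.isLow231_iff y).2 (Or.inr (Or.inl ⟨hy, x₀, hx₀, h3⟩))))
    · intro h1 a ha
      have hL : ∀ b ∈ L, b < y := by
        intro b hb
        by_contra h2
        have h3 := above_lt_above hy h1 (not_lt.1 h2)
        have := hi b hb
        omega
      rcases (h.isLow231_iff a).1 ha with h2 | ⟨-, b, hb, h2⟩ | h2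
      · exact hL a h2.mem
      · exact h2.trans (hL b hb)
      · exact (h.lt_of_isLow231 hx₀ h2).trans h1
  have hL : List.countP (fun x => decide (IsHigh (L ++ M :: R) x)) L =
      highCount (L.filter (above R · = i)) := by
    unfold highCount
    rw [List.countP_filter]
    refine List.countP_congr fun x hx => ?_
    simp only [decide_eq_true_eq, Bool.and_eq_true]
    constructor
    · intro h1
      refine ⟨fun a ha => h1 a ((h.isLow231_iff a).2
        (Or.inl (ha.sublist List.filter_sublist))), ?_⟩
      by_contra h2
      have h3 := hi x hx
      obtain ⟨r, hr, h4, h5⟩ := exists_between_of_above_lt (R := R) (x := x) (y := x₀) (by omega)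
      have h6 := h1 r ((h.isLow231_iff r).2 (Or.inr (Or.inl ⟨hr, x₀, hx₀,
        lt_of_le_of_ne h5 (h.ne hx₀ hr).symm⟩)))
      omega
    · rintro ⟨h1, h2⟩ a ha
      rcases (h.isLow231_iff a).1 ha with ⟨b, c, hs, hab, hbc⟩ | ⟨haR, b, hb, hab⟩ | h3
      · have haL : a ∈ L := hs.subset (by simp)
        have hbL : b ∈ L := hs.subset (by simp)
        have hcL : c ∈ L := hs.subset (by simp)
        have ha' := hi a haL
        have hb' := hi b hbL
        have hc' := hi c hcL
        by_cases h3 : above R a = i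
        · have h4 : above R b = i := by
            by_contra h5
            have := lt_of_above_lt (R := R) (x := b) (y := a) (by omega)
            omega
          have h6 : above R c = i := by
            by_contra h5
            have := lt_of_above_lt (R := R) (x := c) (y := b) (by omega)
            omega
          refine h1 a ⟨b, c, ?_, hab, hbc⟩
          have h7 := hs.filter (above R · = i)
          simpa [List.filter_cons, h3, h4, h6] using h7
        · exact lt_of_above_lt (R := R) (by omega)
      · by_contra h3
        have h4 : x < a := lt_of_le_of_ne (not_lt.1 h3) (h.ne hx haR)
        have h5 := above_lt_above haR h4 hab.le
        have := hi b hb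
        omega
      · exact h.lt_of_isLow231 hx h3
  rw [← hL, highCount, List.countP_append, List.countP_cons, hR,
    if_pos (by simpa using h.isHigh_max)]
  omega

end Split

/-! ### Recovering a word from its standardized parts -/

lemma eq_filter_append_filter {α : Type*} (key : α → ℕ) (m : ℕ) (l : List α)
    (hl : l.Pairwise (fun x y => key x ≤ key y)) (hm : ∀ x ∈ l, key x ≤ m) :
    l = l.filter (key · < m) ++ l.filter (key · = m) := by
  induction l with
  | nil => rfl
  | cons x t ih =>
    rw [List.pairwise_cons] at hl
    have ht := ih hl.2 fun y hy => hm y (by simp [hy])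
    have hx := hm x (by simp)
    rcases hx.lt_or_eq with h | h
    · rw [List.filter_cons, List.filter_cons, if_pos (by simpa using h),
        if_neg (by simpa using h.ne), List.cons_append, ← ht]
    · have h1 : ∀ y ∈ x :: t, key y = m := by
        intro y hy
        rcases List.mem_cons.1 hy with rfl | hy
        · exact h
        · exact le_antisymm (hm y (by simp [hy])) (h ▸ hl.1 y hy)
      rw [List.filter_eq_nil_iff.2 (by intro y hy; simpa using (h1 y hy).ge),
        List.filter_eq_self.2 (by intro y hy; simpa using h1 y hy), List.nil_append]

lemma eq_flatMap_filter {α : Type*} (key : α → ℕ) (m : ℕ) (l : List α)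
    (hl : l.Pairwise (fun x y => key x ≤ key y)) (hm : ∀ x ∈ l, key x < m) :
    l = (List.range m).flatMap (fun j => l.filter (key · = j)) := by
  induction m generalizing l with
  | zero =>
    rw [List.eq_nil_iff_forall_not_mem.2 fun x hx => absurd (hm x hx) (by omega)]
    rfl
  | succ m ih =>
    have h1 := eq_filter_append_filter key m l hl fun x hx => Nat.lt_succ_iff.1 (hm x hx)
    have h2 := ih (l.filter (key · < m)) (hl.sublist List.filter_sublist) fun x hx => by
      simpa using (List.mem_filter.1 hx).2
    rw [List.range_succ, List.flatMap_append, List.flatMap_singleton]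
    conv_lhs => rw [h1, h2]
    congr 1
    refine List.flatMap_congr fun j hj => ?_
    rw [List.filter_filter]
    refine List.filter_congr fun x _ => ?_
    have := List.mem_range.1 hj
    by_cases hk : key x = j
    · simp [hk, this]
    · simp [hk]

lemma map_eq_flatMap_replicate {α : Type*} (key : α → ℕ) (m : ℕ) (l : List α)
    (hl : l.Pairwise (fun x y => key x ≤ key y)) (hm : ∀ x ∈ l, key x < m) :
    l.map key = (List.range m).flatMap
      (fun j => List.replicate (l.filter (key · = j)).length j) := by
  conv_lhs => rw [eq_flatMap_filter key m l hl hm]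
  rw [List.map_flatMap]
  refine List.flatMap_congr fun j _ => ?_
  refine List.eq_replicate_iff.2 ⟨by simp, fun y hy => ?_⟩
  obtain ⟨x, hx, rfl⟩ := List.mem_map.1 hy
  simpa using (List.mem_filter.1 hx).2

lemma countP_lt_add_above {R : List ℕ} {y : ℕ} (hR : R.Nodup) (hy : y ∈ R) :
    R.countP (· < y) + 1 + above R y = R.length := by
  have h1 := List.length_eq_countP_add_countP (l := R) (fun z => decide (z < y))
  have h2 : R.countP (fun z => !decide (z < y)) = 1 + above R y := by
    obtain ⟨s, t, rfl⟩ := List.append_of_mem hy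
    have h3 := List.nodup_append.1 hR
    have h4 := List.nodup_cons.1 h3.2.1
    have hs : s.countP (fun z => !decide (z < y)) = s.countP (y < ·) := by
      refine List.countP_congr fun z hz => ?_
      have := h3.2.2 z hz y (by simp)
      simp
      omega
    have ht : t.countP (fun z => !decide (z < y)) = t.countP (y < ·) := by
      refine List.countP_congr fun z hz => ?_
      have : z ≠ y := fun h => h4.1 (h ▸ hz)
      simp
      omega
    rw [above, List.countP_append, List.countP_cons, List.countP_append, List.countP_cons, hs, ht]
    simp
    omega
  simp only [decide_not, Bool.not_eq_true, decide_eq_false_iff_not] at h1 h2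
  omega

lemma countP_lt_add_above_of_notMem {R : List ℕ} {y : ℕ} (hy : y ∉ R) :
    R.countP (· < y) + above R y = R.length := by
  have h1 := List.length_eq_countP_add_countP (l := R) (fun z => decide (z < y))
  have h2 : R.countP (fun z => !decide (z < y)) = above R y := by
    refine List.countP_congr fun z hz => ?_
    have : z ≠ y := fun h => hy (h ▸ hz)
    simp
    omega
  simp only [decide_not, Bool.not_eq_true, decide_eq_false_iff_not] at h1 h2
  omega

namespace Split

variable {L R L' R' : List ℕ} {M M' n n' : ℕ}

lemma nodup_right (h : Split L R M) : R.Nodup :=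
  (List.nodup_cons.1 (List.nodup_append.1 h.nodup).2.1).2

lemma notMem_right (h : Split L R M) {x : ℕ} (hx : x ∈ L) : x ∉ R := fun hy => h.ne hx hy rfl

lemma above_lt (R : List ℕ) (x : ℕ) : above R x < R.length + 1 :=
  Nat.lt_succ_of_le List.countP_le_length

/-- An entry to the right of the maximum, computed from its rank on that side and the gaps of the
entries on the left. -/
lemma right_eq (h : Split L R M) (hp : (L ++ M :: R).Perm (List.range n)) {y : ℕ} (hy : y ∈ R) :
    y = R.countP (· < y) +
      (L.map (above R)).countP (R.length - 1 - R.countP (· < y) < ·) := by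
  have h1 := countP_lt_of_perm_range hp (x := y) (by simp [hy])
  have h2 := countP_lt_add_above h.nodup_right hy
  have h3 : L.countP (· < y) =
      (L.map (above R)).countP (R.length - 1 - R.countP (· < y) < ·) := by
    rw [List.countP_map]
    refine List.countP_congr fun x hx => ?_
    simp only [Function.comp, decide_eq_true_eq]
    rw [show R.length - 1 - R.countP (· < y) = above R y by omega]
    exact ⟨fun hxy => above_lt_above hy hxy le_rfl, lt_of_above_lt⟩
  have h4 := h.lt_right y hy
  rw [List.countP_append, List.countP_cons, h3, if_neg (by simp; omega)] at h1
  omega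

/-- An entry to the left of the maximum, computed from its rank in its block and the gaps of the
entries on the left. -/
lemma left_eq (h : Split L R M) (hp : (L ++ M :: R).Perm (List.range n)) {x : ℕ} (hx : x ∈ L) :
    x = (L.filter (above R · = above R x)).countP (· < x) +
      ((L.map (above R)).countP (above R x < ·) + (R.length - above R x)) := by
  have h1 := countP_lt_of_perm_range hp (x := x) (by simp [hx])
  have h2 := countP_lt_add_above_of_notMem (h.notMem_right hx)
  have h3 : L.countP (· < x) = (L.filter (above R · = above R x)).countP (· < x) +
      (L.map (above R)).countP (above R x < ·) := by
    have h5 := List.countP_eq_countP_filter_add L (fun z => decide (z < x))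
      (fun z => decide (above R z = above R x))
    rw [h5, List.countP_map]
    congr 1
    rw [List.countP_filter]
    refine List.countP_congr fun z hz => ?_
    simp only [Function.comp, decide_eq_true_eq, Bool.and_eq_true, Bool.not_eq_true',
      decide_eq_false_iff_not]
    constructor
    · rintro ⟨h6, h7⟩
      by_contra h8
      have := lt_of_above_lt (R := R) (x := x) (y := z) (by omega)
      omega
    · intro h6
      exact ⟨lt_of_above_lt h6, h6.ne'⟩
  have h4 := h.lt_left x hx
  rw [List.countP_append, List.countP_cons, h3, if_neg (by simp; omega)] at h1
  omega

lemma max_eq (h : Split L R M) (hp : (L ++ M :: R).Perm (List.range n)) :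
    M = L.length + R.length := by
  have h1 := countP_lt_of_perm_range hp (x := M) (by simp)
  rw [List.countP_append, List.countP_cons, List.countP_eq_length.2 (by simpa using h.lt_left),
    List.countP_eq_length.2 (by simpa using h.lt_right)] at h1
  simp at h1
  omega

/-- A rearrangement of `0, …, n - 1` that avoids `1342` is determined by the order types of the part
to the right of its maximum and of the blocks to the left of it, the `j`-th block consisting of the
entries with exactly `j` entries of the right part above them. -/
lemma eq_of_std_eq (h : Split L R M) (h' : Split L' R' M')
    (hp : (L ++ M :: R).Perm (List.range n)) (hp' : (L' ++ M' :: R').Perm (List.range n'))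
    (hR : std R = std R')
    (hL : ∀ j, std (L.filter (above R · = j)) = std (L'.filter (above R' · = j))) :
    L ++ M :: R = L' ++ M' :: R' := by
  have hlen : R.length = R'.length := by rw [← length_std, hR, length_std]
  have hgap : L.map (above R) = L'.map (above R') := by
    rw [map_eq_flatMap_replicate _ _ L h.pairwise_above fun x _ => above_lt R x,
      map_eq_flatMap_replicate _ _ L' h'.pairwise_above fun x _ => above_lt R' x, hlen]
    refine List.flatMap_congr fun j _ => ?_
    rw [← length_std, hL, length_std]
  have e1 : R = R' := by
    have h1 : R = (std R).map
        fun k => k + (L.map (above R)).countP (R.length - 1 - k < ·) := by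
      rw [std, List.map_map]
      conv_lhs => rw [← List.map_id R]
      exact List.map_congr_left fun y hy => h.right_eq hp hy
    have h2 : R' = (std R').map
        fun k => k + (L'.map (above R')).countP (R'.length - 1 - k < ·) := by
      rw [std, List.map_map]
      conv_lhs => rw [← List.map_id R']
      exact List.map_congr_left fun y hy => h'.right_eq hp' hy
    rw [h1, h2, hR, hgap, hlen]
  have e2 : ∀ j, L.filter (above R · = j) = L'.filter (above R' · = j) := by
    intro j
    have h1 : L.filter (above R · = j) = (std (L.filter (above R · = j))).map
        fun k => k + ((L.map (above R)).countP (j < ·) + (R.length - j)) := by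
      rw [std, List.map_map]
      conv_lhs => rw [← List.map_id (L.filter (above R · = j))]
      refine List.map_congr_left fun y hy => ?_
      have hy' := List.mem_filter.1 hy
      have hj : above R y = j := by simpa using hy'.2
      subst hj
      exact h.left_eq hp hy'.1
    have h2 : L'.filter (above R' · = j) = (std (L'.filter (above R' · = j))).map
        fun k => k + ((L'.map (above R')).countP (j < ·) + (R'.length - j)) := by
      rw [std, List.map_map]
      conv_lhs => rw [← List.map_id (L'.filter (above R' · = j))]
      refine List.map_congr_left fun y hy => ?_
      have hy' := List.mem_filter.1 hy
      have hj : above R' y = j := by simpa using hy'.2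
      subst hj
      exact h'.left_eq hp' hy'.1
    rw [h1, h2, hL, hgap, hlen]
  have e3 : L = L' := by
    rw [eq_flatMap_filter _ _ L h.pairwise_above fun x _ => above_lt R x,
      eq_flatMap_filter _ _ L' h'.pairwise_above fun x _ => above_lt R' x, hlen]
    exact List.flatMap_congr fun j _ => e2 j
  have e4 : M = M' := by rw [h.max_eq hp, h'.max_eq hp', e1, e3]
  rw [e1, e3, e4]

end Split

end PatternAvoidance

namespace PatternAvoidance

open Finset

/-! ### The generating function of `1342`-avoiding words at `1/8` -/

open Classical in
/-- The `1342`-avoiding rearrangements of `0, …, n - 1` with `n ≤ N`. -/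
noncomputable def avoiders (N : ℕ) : Finset (List ℕ) :=
  (range (N + 1)).biUnion fun n =>
    ((List.range n).permutations.toFinset).filter Avoids1342

lemma mem_avoiders {N : ℕ} {l : List ℕ} :
    l ∈ avoiders N ↔ l.length ≤ N ∧ l.Perm (List.range l.length) ∧ Avoids1342 l := by
  simp only [avoiders, mem_biUnion, mem_range, mem_filter, List.mem_toFinset, List.mem_permutations]
  constructor
  · rintro ⟨n, hn, hp, ha⟩
    have h : l.length = n := by simpa using hp.length_eq
    rw [h]
    exact ⟨by omega, hp, ha⟩
  · rintro ⟨h1, h2, h3⟩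
    exact ⟨l.length, by omega, h2, h3⟩

lemma nodup_of_mem_avoiders {N : ℕ} {l : List ℕ} (h : l ∈ avoiders N) : l.Nodup :=
  (mem_avoiders.1 h).2.1.nodup_iff.2 List.nodup_range

lemma std_mem_avoiders {N K : ℕ} {l l' : List ℕ} (h : l ∈ avoiders N) (hs : l'.Sublist l)
    (hl : l'.length ≤ K) : std l' ∈ avoiders K := by
  rw [mem_avoiders, length_std]
  exact ⟨hl, std_perm_range ((nodup_of_mem_avoiders h).sublist hs),
    ((mem_avoiders.1 h).2.2.sublist hs).std⟩

lemma one_le_highCount {l : List ℕ} (hl : l ≠ []) : 1 ≤ highCount l := by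
  obtain ⟨x, hx, hmax⟩ := Finset.exists_max_image l.toFinset id
    (by rwa [List.toFinset_nonempty_iff])
  refine List.countP_pos_iff.2 ⟨x, by simpa using hx, ?_⟩
  simp only [decide_eq_true_eq]
  rintro a ⟨b, c, hs, h1, -⟩
  have h2 : b ≤ x := hmax b (List.mem_toFinset.2 (hs.subset (by simp)))
  omega

lemma exists_split {N : ℕ} {l : List ℕ} (h : l ∈ avoiders N) (hl : l ≠ []) :
    ∃ L R M, l = L ++ M :: R ∧ Split L R M := by
  obtain ⟨-, hp, ha⟩ := mem_avoiders.1 h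
  have hpos : 0 < l.length := List.length_pos_iff.2 hl
  have hM : l.length - 1 ∈ l := hp.symm.subset (by simp; omega)
  obtain ⟨L, R, he⟩ := List.append_of_mem hM
  generalize hMM : l.length - 1 = M at he
  have hn := nodup_of_mem_avoiders h
  have hlt : ∀ x ∈ l, x ≤ M := fun x hx => by
    have := List.mem_range.1 (hp.subset hx)
    omega
  refine ⟨L, R, M, he, he ▸ hn, ?_, ?_, he ▸ ha⟩
  · intro x hx
    refine lt_of_le_of_ne (hlt x (by simp [he, hx])) ?_
    rw [he] at hn
    exact (List.nodup_append.1 hn).2.2 x hx M (by simp)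
  · intro x hx
    refine lt_of_le_of_ne (hlt x (by simp [he, hx])) ?_
    rw [he] at hn
    rintro rfl
    exact (List.nodup_cons.1 (List.nodup_append.1 hn).2.1).1 hx

/-- The sequences of length `m` with entries in `F`. -/
def seqs {α : Type*} [DecidableEq α] (F : Finset α) : ℕ → Finset (List α)
  | 0 => {[]}
  | m + 1 => (F ×ˢ seqs F m).image fun q => q.1 :: q.2

lemma cons_injOn {α : Type*} (s : Set (α × List α)) :
    Set.InjOn (fun q : α × List α => q.1 :: q.2) s := by
  rintro ⟨a, r⟩ - ⟨a', r'⟩ - h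
  simpa using h

section seqs

variable {α : Type*} [DecidableEq α] {F : Finset α}

lemma mem_seqs {m : ℕ} {r : List α} : r ∈ seqs F m ↔ r.length = m ∧ ∀ a ∈ r, a ∈ F := by
  induction m generalizing r with
  | zero =>
    simp only [seqs, mem_singleton, List.length_eq_zero_iff]
    constructor
    · rintro rfl
      simp
    · exact fun h => h.1
  | succ m ih =>
    simp only [seqs, mem_image, mem_product, Prod.exists]
    constructor
    · rintro ⟨a, s, ⟨ha, hs⟩, rfl⟩
      obtain ⟨h1, h2⟩ := ih.1 hs
      simpa [h1, ha] using h2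
    · rintro ⟨h1, h2⟩
      obtain ⟨a, s, rfl⟩ := List.exists_cons_of_length_eq_add_one h1
      exact ⟨a, s, ⟨h2 a (by simp), ih.2 ⟨by simpa using h1, fun b hb => h2 b (by simp [hb])⟩⟩, rfl⟩

lemma sum_seqs (w : ℝ) (len : α → ℕ) (m : ℕ) :
    ∑ r ∈ seqs F m, w ^ (r.map len).sum = (∑ a ∈ F, w ^ len a) ^ m := by
  induction m with
  | zero => simp [seqs]
  | succ m ih =>
    rw [seqs, Finset.sum_image (cons_injOn _), pow_succ', ← ih, Finset.sum_mul_sum,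
      ← Finset.sum_product']
    refine Finset.sum_congr rfl fun q _ => ?_
    simp [pow_add]

end seqs

namespace Split

variable {L R : List ℕ} {M : ℕ}

lemma exists_min_above (h : Split L R M) (hL : L ≠ []) :
    ∃ x₀ ∈ L, ∀ x ∈ L, above R x₀ ≤ above R x := by
  obtain ⟨x₀, t, rfl⟩ := List.exists_cons_of_ne_nil hL
  refine ⟨x₀, by simp, fun x hx => ?_⟩
  rcases List.mem_cons.1 hx with rfl | hx
  · exact le_rfl
  · exact (List.pairwise_cons.1 h.pairwise_above).1 x hx

lemma length_left (h : Split L R M) {i : ℕ} (hi : ∀ x ∈ L, i ≤ above R x)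
    (hiT : i ≤ highCount R) :
    L.length = (L.filter (above R · = i)).length +
      ((List.range (highCount R - i)).map
        fun k => (L.filter (above R · = i + 1 + k)).length).sum := by
  obtain ⟨d, hd⟩ := Nat.exists_eq_add_of_le hiT
  have h1 := congrArg List.length (eq_flatMap_filter (above R) (highCount R + 1) L h.pairwise_above
    fun x hx => Nat.lt_succ_of_le (h.above_le_highCount hx))
  -- the blocks above the topmost nonempty one contribute nothing
  have h0 : ((List.range i).map fun j => (L.filter (above R · = j)).length).sum = 0 := by
    refine List.sum_eq_zero fun y hy => ?_
    obtain ⟨j, hj, rfl⟩ := List.mem_map.1 hy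
    rw [List.length_eq_zero_iff, List.filter_eq_nil_iff]
    intro x hx
    have := hi x hx
    have := List.mem_range.1 hj
    simp
    omega
  rw [List.length_flatMap, hd, show i + d + 1 = i + (1 + d) by ring, List.range_add,
    List.map_append, List.sum_append, h0, List.range_add] at h1
  rw [hd, Nat.add_sub_cancel_left]
  simpa [Function.comp_def, add_assoc] using h1

end Split

/-- The total weight `∑ (1 / 8) ^ |l|` of the avoiding words of length at most `N` with `t` high
entries. -/
noncomputable def weightSum (N t : ℕ) : ℝ :=
  ∑ l ∈ (avoiders N).filter (highCount · = t), (1 / 8 : ℝ) ^ l.length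

lemma highCount_le_of_mem {N : ℕ} {l : List ℕ} (h : l ∈ avoiders N) : highCount l ≤ N :=
  (highCount_le_length l).trans (mem_avoiders.1 h).1

/-- Summing the bounds `φ t` over all `t` bounds the whole generating function by `α = 32 / 27`. -/
lemma sum_avoiders_le {N : ℕ} (hN : ∀ t, weightSum N t ≤ phi t) :
    ∑ l ∈ avoiders N, (1 / 8 : ℝ) ^ l.length ≤ 32 / 27 := by
  rw [← Finset.sum_fiberwise_of_maps_to (t := range (N + 1)) (g := highCount)
    fun l hl => mem_range.2 (Nat.lt_succ_of_le (highCount_le_of_mem hl))]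
  exact (Finset.sum_le_sum fun t _ => hN t).trans (sum_phi_le _)

/-- The total weight of the right parts with at least `i` high entries, together with one arbitrary
block for each of the gaps below the topmost nonempty one. -/
lemma sum_avoiders_mul_pow_le {N : ℕ} (hN : ∀ t, weightSum N t ≤ phi t) (i : ℕ) :
    ∑ R ∈ (avoiders N).filter (i ≤ highCount ·),
      (1 / 8 : ℝ) ^ R.length * (32 / 27) ^ (highCount R - i) ≤ psi i := by
  rw [← Finset.sum_fiberwise_of_maps_to (t := range (N + 1)) (g := fun R => highCount R - i)
    fun l hl => mem_range.2 (by have := highCount_le_of_mem (mem_filter.1 hl).1; omega)]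
  refine le_trans (Finset.sum_le_sum fun k _ => ?_) (sum_phi_mul_pow_le_psi i (range (N + 1)))
  refine le_trans (le_of_eq ?_) (mul_le_mul_of_nonneg_right (hN (i + k)) (by positivity))
  rw [weightSum, Finset.sum_mul, Finset.filter_filter]
  refine Finset.sum_congr ?_ fun R hR => ?_
  · ext R
    simp only [mem_filter]
    constructor
    · rintro ⟨h1, h2, h3⟩
      exact ⟨h1, by omega⟩
    · rintro ⟨h1, h2⟩
      exact ⟨h1, by omega, by omega⟩
  · rw [(mem_filter.1 hR).2, Nat.add_sub_cancel_left]

lemma weightSum_zero_le (N : ℕ) : weightSum N 0 ≤ phi 0 := by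
  have h : (avoiders N).filter (highCount · = 0) ⊆ {[]} := by
    intro l hl
    rw [mem_singleton]
    by_contra h
    have := one_le_highCount h
    have := (mem_filter.1 hl).2
    omega
  refine (Finset.sum_le_sum_of_subset_of_nonneg h fun _ _ _ => by positivity).trans ?_
  simp [phi_zero]

/-- One step of the recursion: a word with `n + 1` high entries is either its maximum followed by
a word with `n` high entries, or is encoded by the number `i` of high entries on the right of the
maximum, the standardized right part, the standardized topmost block on the left, and the
sequence of the other standardized blocks. -/
lemma weightSum_succ_le {N : ℕ} (hN : ∀ t, weightSum N t ≤ phi t) (n : ℕ) :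
    weightSum (N + 1) (n + 1) ≤ phi (n + 1) := by
  classical
  have hsplit : ∀ l ∈ (avoiders (N + 1)).filter (highCount · = n + 1),
      ∃ L R M, l = L ++ M :: R ∧ Split L R M := by
    intro l hl
    refine exists_split (mem_filter.1 hl).1 ?_
    rintro rfl
    have := (mem_filter.1 hl).2
    simp [highCount] at this
  choose! Lf Rf Mf hl hS using hsplit
  have hperm : ∀ l ∈ (avoiders (N + 1)).filter (highCount · = n + 1),
      (Lf l ++ Mf l :: Rf l).Perm (List.range l.length) := by
    intro l h
    rw [← hl l h]
    exact (mem_avoiders.1 (mem_filter.1 h).1).2.1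
  have hlength : ∀ l ∈ (avoiders (N + 1)).filter (highCount · = n + 1),
      l.length = (Lf l).length + (Rf l).length + 1 := by
    intro l h
    conv_lhs => rw [hl l h]
    simp
    omega
  have hlengthN : ∀ l ∈ (avoiders (N + 1)).filter (highCount · = n + 1),
      (Lf l).length + (Rf l).length ≤ N := by
    intro l h
    have := hlength l h
    have := (mem_avoiders.1 (mem_filter.1 h).1).1
    omega
  have hsubL : ∀ l ∈ (avoiders (N + 1)).filter (highCount · = n + 1), (Lf l).Sublist l := by
    intro l h
    conv_rhs => rw [hl l h]
    exact List.sublist_append_left _ _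
  have hsubR : ∀ l ∈ (avoiders (N + 1)).filter (highCount · = n + 1), (Rf l).Sublist l := by
    intro l h
    conv_rhs => rw [hl l h]
    exact (List.sublist_cons_self _ _).trans (List.sublist_append_right _ _)
  rw [weightSum, ← Finset.sum_filter_add_sum_filter_not _ (fun l => Lf l = []), phi_succ, mul_add]
  refine add_le_add ?_ ?_
  -- words starting with their maximum
  · refine le_trans ?_ (mul_le_mul_of_nonneg_left (hN n) (by norm_num))
    rw [weightSum, Finset.mul_sum]
    refine sum_le_sum_of_injOn (fun l => std (Rf l)) ?_ ?_ ?_ fun _ _ => by positivity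
    · intro l h
      obtain ⟨h1, h2⟩ := mem_filter.1 h
      have h3 := hlengthN l h1
      rw [mem_filter]
      refine ⟨std_mem_avoiders (mem_filter.1 h1).1 (hsubR l h1) (by omega), ?_⟩
      have h4 := (mem_filter.1 h1).2
      have h5 := hS l h1
      rw [hl l h1] at h4
      rw [h2] at h4 h5
      rw [h5.highCount_nil] at h4
      rw [highCount_std]
      omega
    · intro l h l' h' he
      obtain ⟨h1, h2⟩ := mem_filter.1 h
      obtain ⟨h1', h2'⟩ := mem_filter.1 h'
      rw [hl l h1, hl l' h1']
      refine (hS l h1).eq_of_std_eq (hS l' h1') (hperm l h1) (hperm l' h1') he fun j => ?_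
      rw [h2, h2']
      rfl
    · intro l h
      obtain ⟨h1, h2⟩ := mem_filter.1 h
      rw [hlength l h1, h2, length_std, pow_succ]
      simp [mul_comm]
  -- the other words, by the gap `i` of the topmost entries on the left of the maximum
  · have hi : ∀ l ∈ ((avoiders (N + 1)).filter (highCount · = n + 1)).filter (¬ Lf · = []),
        ∃ i, ∃ x₀ ∈ Lf l, above (Rf l) x₀ = i ∧ ∀ x ∈ Lf l, i ≤ above (Rf l) x := by
      intro l h
      obtain ⟨h1, h2⟩ := mem_filter.1 h
      obtain ⟨x₀, hx₀, hm⟩ := (hS l h1).exists_min_above h2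
      exact ⟨_, x₀, hx₀, rfl, hm⟩
    choose! i x₀ hx₀ hi hmin using hi
    set B : List ℕ → ℕ → List ℕ := fun l j => (Lf l).filter (above (Rf l) · = j) with hB
    have hBnil : ∀ l ∈ ((avoiders (N + 1)).filter (highCount · = n + 1)).filter (¬ Lf · = []),
        ∀ j, (j < i l ∨ highCount (Rf l) < j) → B l j = [] := by
      intro l h j hj
      obtain ⟨h1, h2⟩ := mem_filter.1 h
      rw [hB, List.filter_eq_nil_iff]
      intro x hx
      have h3 := hmin l h x hx
      have h4 := (hS l h1).above_le_highCount hx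
      simp
      omega
    have hiT : ∀ l ∈ ((avoiders (N + 1)).filter (highCount · = n + 1)).filter (¬ Lf · = []),
        i l ≤ highCount (Rf l) := by
      intro l h
      rw [← hi l h]
      exact (hS l (mem_filter.1 h).1).above_le_highCount (hx₀ l h)
    have hBmem : ∀ l ∈ ((avoiders (N + 1)).filter (highCount · = n + 1)).filter (¬ Lf · = []),
        ∀ j, std (B l j) ∈ avoiders N := by
      intro l h j
      obtain ⟨h1, h2⟩ := mem_filter.1 h
      have h3 := hlengthN l h1
      have h4 : (B l j).length ≤ (Lf l).length := List.length_filter_le _ _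
      exact std_mem_avoiders (mem_filter.1 h1).1 (List.filter_sublist.trans (hsubL l h1)) (by omega)
    have hcode : ∑ l ∈ ((avoiders (N + 1)).filter (highCount · = n + 1)).filter (¬ Lf · = []),
        (1 / 8 : ℝ) ^ l.length ≤
        ∑ c ∈ ((HasAntidiagonal.antidiagonal n).filter (fun ij => 1 ≤ ij.2)).sigma (fun ij =>
          ((avoiders N).filter (ij.1 ≤ highCount ·)).sigma (fun R =>
            ((avoiders N).filter (highCount · = ij.2)).sigma (fun _ =>
              seqs (avoiders N) (highCount R - ij.1)))),
          1 / 8 * ((1 / 8 : ℝ) ^ c.2.1.length * ((1 / 8 : ℝ) ^ c.2.2.1.length *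
            (1 / 8 : ℝ) ^ (c.2.2.2.map List.length).sum)) := by
      refine sum_le_sum_of_injOn (fun l => ⟨(i l, highCount (B l (i l))), std (Rf l),
        std (B l (i l)), (List.range (highCount (Rf l) - i l)).map
          fun k => std (B l (i l + 1 + k))⟩) ?_ ?_ ?_ fun _ _ => by positivity
      · intro l h
        obtain ⟨h1, h2⟩ := mem_filter.1 h
        have h3 := hlengthN l h1
        have h4 := (hS l h1).highCount_eq (hmin l h) (hx₀ l h) (hi l h)
        rw [← hl l h1, (mem_filter.1 h1).2] at h4
        have h5 : 1 ≤ highCount (B l (i l)) := by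
          refine one_le_highCount fun h6 => ?_
          rw [hB, List.filter_eq_nil_iff] at h6
          exact h6 (x₀ l) (hx₀ l h) (by simpa using hi l h)
        simp only [mem_sigma, mem_filter, HasAntidiagonal.mem_antidiagonal, highCount_std, mem_seqs,
          List.length_map, List.length_range, and_true, true_and]
        have h6 : i l + highCount (B l (i l)) = n := by
          simp only [hB]
          omega
        refine ⟨⟨h6, h5⟩,
          ⟨std_mem_avoiders (mem_filter.1 h1).1 (hsubR l h1) (by omega), hiT l h⟩,
          hBmem l h _, ?_⟩
        intro a ha
        obtain ⟨k, -, rfl⟩ := List.mem_map.1 ha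
        exact hBmem l h _
      · intro l h l' h' he
        obtain ⟨h1, h2⟩ := mem_filter.1 h
        obtain ⟨h1', h2'⟩ := mem_filter.1 h'
        simp only [Sigma.mk.injEq, Prod.mk.injEq, heq_eq_eq] at he
        obtain ⟨⟨e1, -⟩, e2, e3, e4⟩ := he
        have e5 : highCount (Rf l) = highCount (Rf l') := by
          rw [← highCount_std, e2, highCount_std]
        rw [hl l h1, hl l' h1']
        refine (hS l h1).eq_of_std_eq (hS l' h1') (hperm l h1) (hperm l' h1') e2 fun j => ?_
        change std (B l j) = std (B l' j)
        rw [e1, e5, List.map_inj_left] at e4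
        rcases lt_trichotomy j (i l') with hj | hj | hj
        · rw [hBnil l h j (by omega), hBnil l' h' j (by omega)]
        · rw [hj]
          rw [e1] at e3
          exact e3
        · by_cases hj2 : highCount (Rf l') < j
          · rw [hBnil l h j (by omega), hBnil l' h' j (by omega)]
          · have h6 := e4 (j - i l' - 1) (by rw [List.mem_range]; omega)
            rwa [show i l' + 1 + (j - i l' - 1) = j by omega] at h6
      · intro l h
        obtain ⟨h1, h2⟩ := mem_filter.1 h
        dsimp only
        have h3 := (hS l h1).length_left (hmin l h) (hiT l h)
        rw [hlength l h1, h3, length_std, length_std, List.map_map]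
        simp only [Function.comp_def, length_std]
        rw [← pow_add, ← pow_add, ← pow_succ']
        refine le_of_eq (congrArg _ ?_)
        simp only [hB]
        ring
    refine hcode.trans ?_
    rw [Finset.sum_sigma, Finset.mul_sum]
    refine Finset.sum_le_sum fun ij _ => ?_
    simp only [Finset.sum_sigma, ← Finset.mul_sum, sum_seqs]
    refine mul_le_mul_of_nonneg_left ?_ (by norm_num)
    have h1 : ∀ R ∈ (avoiders N).filter (ij.1 ≤ highCount ·), (1 / 8 : ℝ) ^ R.length *
        ∑ L ∈ (avoiders N).filter (highCount · = ij.2), (1 / 8 : ℝ) ^ L.length *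
          (∑ a ∈ avoiders N, (1 / 8 : ℝ) ^ a.length) ^ (highCount R - ij.1) ≤
        ((1 / 8 : ℝ) ^ R.length * (32 / 27) ^ (highCount R - ij.1)) * phi ij.2 := by
      intro R _
      rw [← Finset.sum_mul, mul_assoc, mul_comm ((32 / 27 : ℝ) ^ _)]
      refine mul_le_mul_of_nonneg_left ?_ (by positivity)
      refine mul_le_mul (hN ij.2) ?_ (by positivity) (phi_nonneg _)
      exact pow_le_pow_left₀ (Finset.sum_nonneg fun _ _ => by positivity) (sum_avoiders_le hN) _
    refine (Finset.sum_le_sum h1).trans ?_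
    rw [← Finset.sum_mul]
    exact mul_le_mul_of_nonneg_right (sum_avoiders_mul_pow_le hN ij.1) (phi_nonneg _)

lemma weightSum_le_phi (N t : ℕ) : weightSum N t ≤ phi t := by
  induction N generalizing t with
  | zero =>
    rcases t with _ | t
    · exact weightSum_zero_le 0
    · refine le_trans (le_of_eq (Finset.sum_eq_zero fun l hl => ?_)) (phi_nonneg _)
      have h1 := highCount_le_of_mem (mem_filter.1 hl).1
      have h2 := (mem_filter.1 hl).2
      omega
  | succ N ih =>
    rcases t with _ | t
    · exact weightSum_zero_le _
    · exact weightSum_succ_le ih t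

/-! ### From permutations to words -/

lemma avoids1342_ofFn {n : ℕ} (p : Equiv.Perm (Fin n)) (hp : Avoids p pattern1342) :
    Avoids1342 (List.ofFn fun i => (p i : ℕ)) := by
  intro a b c d hs hlt
  refine hp ?_
  obtain ⟨f, hf⟩ := List.sublist_iff_exists_fin_orderEmbedding_get_eq.1 hs
  have hlen : (List.ofFn fun i => (p i : ℕ)).length = n := List.length_ofFn
  refine ⟨fun k => Fin.cast hlen (f k), fun x y hxy => f.strictMono hxy, ?_⟩
  have h : ∀ k : Fin 4, (p (Fin.cast hlen (f k)) : ℕ) = [a, b, c, d].get k := by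
    intro k
    rw [hf k]
    simp
    rfl
  intro x y
  rw [Fin.lt_def, Fin.lt_def (a := p _), h, h]
  fin_cases x <;> fin_cases y <;> simp [pattern1342] <;> omega

lemma card_avoids1342_le (n : ℕ) : (S n pattern1342 : ℝ) ≤ 32 / 27 * 8 ^ n := by
  classical
  have h1 := sum_avoiders_le (weightSum_le_phi n)
  have h2 : ∑ p ∈ Finset.univ.filter (fun p : Equiv.Perm (Fin n) => Avoids p pattern1342),
      (1 / 8 : ℝ) ^ n ≤ ∑ l ∈ avoiders n, (1 / 8 : ℝ) ^ l.length := by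
    refine sum_le_sum_of_injOn (fun p => List.ofFn fun i => (p i : ℕ)) ?_ ?_ ?_
      fun _ _ => by positivity
    · intro p hp
      rw [mem_avoiders, List.length_ofFn]
      refine ⟨le_rfl, ?_, avoids1342_ofFn p (mem_filter.1 hp).2⟩
      have h3 : (List.ofFn fun i => (p i : ℕ)).Nodup :=
        List.nodup_ofFn.2 (Fin.val_injective.comp p.injective)
      refine (List.subperm_of_subset h3 ?_).perm_of_length_le (by simp)
      intro x hx
      obtain ⟨i, rfl⟩ := (List.mem_ofFn' _ _).1 hx
      simp
    · intro p _ q _ h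
      ext i
      exact congrFun (List.ofFn_injective h) i
    · intro p _
      simp
  rw [Finset.sum_const, nsmul_eq_mul] at h2
  have h3 : (S n pattern1342 : ℝ) =
      (Finset.univ.filter (fun p : Equiv.Perm (Fin n) => Avoids p pattern1342)).card := by
    rw [S, Nat.card_eq_fintype_card, Fintype.card_subtype]
  rw [h3]
  have h4 := h2.trans h1
  rw [one_div, inv_pow, ← div_eq_mul_inv, div_le_iff₀ (by positivity)] at h4
  exact h4

/-! ### Greedy colourings of `1234`-avoiding permutations -/

/-- `c` colours each entry of `p` by the length of the longest increasing subsequence ending there,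
minus one: every colour class is decreasing, and every entry of positive colour has an entry of
the preceding colour below it on its left. -/
structure IsGreedy {n : ℕ} (p : Equiv.Perm (Fin n)) (c : Fin n → ℕ) : Prop where
  anti : ∀ i i', i < i' → c i = c i' → p i' < p i
  exists_pred : ∀ i k, c i = k + 1 → ∃ i' < i, p i' < p i ∧ c i' = k

namespace IsGreedy

variable {n : ℕ} {p : Equiv.Perm (Fin n)} {c c' : Fin n → ℕ}

lemma exists_le (h : IsGreedy p c) (i : Fin n) (k : ℕ) (hk : k ≤ c i) :
    ∃ i' ≤ i, p i' ≤ p i ∧ c i' = k := by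
  obtain ⟨d, hd⟩ := Nat.exists_eq_add_of_le hk
  induction d generalizing i with
  | zero => exact ⟨i, le_rfl, le_rfl, by omega⟩
  | succ d ih =>
    obtain ⟨i₁, h1, h2, h3⟩ := h.exists_pred i (k + d) (by omega)
    obtain ⟨i₂, h4, h5, h6⟩ := ih i₁ (by omega) h3
    exact ⟨i₂, h4.trans h1.le, h5.trans h2.le, h6⟩

lemma lt_of_lt (h : IsGreedy p c) {i i' : Fin n} (hi : i < i') (hp : p i < p i') : c i < c i' := by
  by_contra hc
  obtain ⟨i₁, h1, h2, h3⟩ := h.exists_le i (c i') (not_lt.1 hc)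
  exact absurd (h.anti i₁ i' (h1.trans_lt hi) h3) (not_lt.2 (h2.trans hp.le))

lemma le_of_isGreedy (h : IsGreedy p c) (h' : IsGreedy p c') (i : Fin n) : c i ≤ c' i := by
  induction i using WellFoundedLT.induction with
  | ind i ih =>
    rcases hk : c i with _ | k
    · exact Nat.zero_le _
    · obtain ⟨i', h1, h2, h3⟩ := h.exists_pred i k hk
      have := ih i' h1
      have := h'.lt_of_lt h1 h2
      omega

/-- The permutation determines its greedy colouring. -/
lemma unique (h : IsGreedy p c) (h' : IsGreedy p c') : c = c' :=
  funext fun i => le_antisymm (h.le_of_isGreedy h' i) (h'.le_of_isGreedy h i)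

lemma avoids (h : IsGreedy p c) (hc : ∀ i, c i < 3) : Avoids p pattern1234 := by
  rintro ⟨f, hf, hp⟩
  have h1 : ∀ a b : Fin 4, a < b → pattern1234 a < pattern1234 b → c (f a) < c (f b) :=
    fun a b hab hq => h.lt_of_lt (hf hab) ((hp a b).1 hq)
  have h01 := h1 0 1 (by decide) (by decide)
  have h12 := h1 1 2 (by decide) (by decide)
  have h23 := h1 2 3 (by decide) (by decide)
  have := hc (f 3)
  omega

end IsGreedy

/-- The number of occurrences of `k` among the values of `u` before position `i`. -/
def countBefore {n : ℕ} (u : Fin n → ℕ) (i : Fin n) (k : ℕ) : ℕ :=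
  (univ.filter fun i' => i' < i ∧ u i' = k).card

/-- Two words with the same content differ by a permutation that is increasing on each letter. -/
lemma exists_perm_comp_eq {n : ℕ} (u v : Fin n → ℕ)
    (h : ∀ k, (univ.filter fun i => u i = k).card = (univ.filter fun i => v i = k).card) :
    ∃ p : Equiv.Perm (Fin n), (∀ i, v (p i) = u i) ∧ ∀ i i', i < i' → u i = u i' → p i < p i' := by
  classical
  have hc : ∀ k, Fintype.card {i // u i = k} = Fintype.card {i // v i = k} := by
    intro k
    rw [Fintype.card_subtype, Fintype.card_subtype, h]
  let e : ∀ k, {i // u i = k} ≃o {i // v i = k} := fun k =>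
    (Fintype.orderIsoFinOfCardEq _ (hc k)).symm.trans (Fintype.orderIsoFinOfCardEq _ rfl)
  let p : Equiv.Perm (Fin n) := (Equiv.sigmaFiberEquiv u).symm.trans
    ((Equiv.sigmaCongrRight fun k => (e k).toEquiv).trans (Equiv.sigmaFiberEquiv v))
  have hp : ∀ k (x : {i // u i = k}), p x = e k x := by
    rintro k ⟨i, rfl⟩
    rfl
  refine ⟨p, fun i => ?_, fun i i' hi hu => ?_⟩
  · have := hp (u i) ⟨i, rfl⟩
    dsimp only at this
    rw [this]
    exact (e (u i) ⟨i, rfl⟩).2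
  · have h1 := hp (u i') ⟨i, hu⟩
    have h2 := hp (u i') ⟨i', rfl⟩
    dsimp only at h1 h2
    rw [h1, h2]
    exact (e (u i')).strictMono (show (⟨i, hu⟩ : {j // u j = u i'}) < ⟨i', rfl⟩ from hi)

/-- Colour the positions by `u` and the values, read downwards, by `v`. If before every letter
`k + 1` the letter `k` leads by more than `j` in `u` and by at most `j` in `v`, then the
permutation with decreasing colour classes determined by `u` and `v` is greedily coloured. -/
lemma exists_isGreedy {n : ℕ} (u v : Fin n → ℕ) (j : ℕ)
    (h : ∀ k, (univ.filter fun i => u i = k).card = (univ.filter fun i => v i = k).card)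
    (hu : ∀ i k, u i = k + 1 → countBefore u i (k + 1) + j < countBefore u i k)
    (hv : ∀ i k, v i = k + 1 → countBefore v i k ≤ countBefore v i (k + 1) + j) :
    ∃ p : Equiv.Perm (Fin n), IsGreedy p u ∧ ∀ i, v (Fin.rev (p i)) = u i := by
  obtain ⟨p, hp1, hp2⟩ := exists_perm_comp_eq u v h
  refine ⟨p.trans Fin.revPerm, ⟨?_, ?_⟩, ?_⟩
  · intro i i' hi hc
    simpa using hp2 i i' hi hc
  · intro i k hk
    have h1 := hu i k hk
    have h2 := hv (p i) k ((hp1 i).trans hk)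
    have h3 : countBefore v (p i) (k + 1) ≤ countBefore u i (k + 1) := by
      refine Finset.card_le_card_of_injOn p.symm ?_ p.symm.injective.injOn
      intro q hq
      simp only [coe_filter, mem_univ, true_and, Set.mem_ofPred_eq] at hq ⊢
      have h4 : u (p.symm q) = k + 1 := by rw [← hp1, Equiv.apply_symm_apply]; exact hq.2
      refine ⟨?_, h4⟩
      by_contra h5
      rcases (not_lt.1 h5).lt_or_eq with h6 | h6
      · have h7 := hp2 i (p.symm q) h6 (hk.trans h4.symm)
        rw [Equiv.apply_symm_apply] at h7
        exact absurd hq.1 (not_lt.2 h7.le)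
      · rw [h6, Equiv.apply_symm_apply] at hq
        exact lt_irrefl _ hq.1
    -- otherwise all letters `k` before `i` would be sent before `p i`
    by_contra hcon
    push Not at hcon
    have h4 : countBefore u i k ≤ countBefore v (p i) k := by
      refine Finset.card_le_card_of_injOn p ?_ p.injective.injOn
      intro i' hi'
      simp only [coe_filter, mem_univ, true_and, Set.mem_ofPred_eq] at hi' ⊢
      refine ⟨?_, (hp1 i').trans hi'.2⟩
      by_contra h5
      have h6 : p i ≠ p i' := fun he => hi'.1.ne (p.injective he).symm
      exact hcon i' hi'.1 (by simpa using lt_of_le_of_ne (not_lt.1 h5) h6) hi'.2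
    omega
  · intro i
    simp [hp1]

lemma count_take_eq {n : ℕ} {l : List ℕ} (hl : l.length = n) (i : Fin n) (k : ℕ) :
    (l.take i).count k = countBefore (fun i : Fin n => l.getD i 0) i k := by
  subst hl
  have h1 : ∀ m, (l.take m).count k = Nat.count (fun m => l[m]? = some k) m := by
    intro m
    induction m with
    | zero => simp
    | succ m ih =>
      rw [List.take_add_one, List.count_append, ih, Nat.count_succ]
      congr 1
      rcases hm : l[m]? with _ | a
      · simp
      · by_cases ha : a = k <;> simp [ha]
  rw [h1, Nat.count_eq_card_filter_range, countBefore]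
  symm
  refine Finset.card_bij (fun i' _ => (i' : ℕ)) ?_ (fun _ _ _ _ h => Fin.ext h) ?_
  · intro i' hi'
    simp only [mem_filter, mem_univ, true_and] at hi'
    simp only [mem_filter, mem_range]
    refine ⟨hi'.1, ?_⟩
    rw [← hi'.2]
    simp
  · intro m hm
    simp only [mem_filter, mem_range] at hm
    have h2 : m < l.length := hm.1.trans i.2
    refine ⟨⟨m, h2⟩, ?_, rfl⟩
    simp only [mem_filter, mem_univ, true_and]
    refine ⟨hm.1, ?_⟩
    simp [hm.2]

lemma card_filter_getD_eq {n : ℕ} {l : List ℕ} (hl : l.length = n) (k : ℕ) :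
    (univ.filter fun i : Fin n => l.getD i 0 = k).card = l.count k := by
  subst hl
  refine Eq.trans ?_
    (Fin.card_filter_univ_eq_vector_get_eq_count k (⟨l, rfl⟩ : List.Vector ℕ l.length))
  congr 1
  refine Finset.filter_congr fun i _ => ?_
  rw [List.getD_eq_getElem _ _ i.2]
  rfl

lemma eq_of_getD_eq {n : ℕ} {l l' : List ℕ} (hl : l.length = n) (hl' : l'.length = n)
    (h : ∀ i : Fin n, l.getD i 0 = l'.getD i 0) : l = l' := by
  refine List.ext_getElem (hl.trans hl'.symm) fun m h1 h2 => ?_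
  have := h ⟨m, hl ▸ h1⟩
  rwa [List.getD_eq_getElem _ _ h1, List.getD_eq_getElem _ _ h2] at this

lemma take_append_getD_prefix {n : ℕ} {l : List ℕ} (hl : l.length = n) (i : Fin n) :
    (l.take i ++ [l.getD i 0]) <+: l := by
  have h : (i : ℕ) < l.length := hl ▸ i.2
  rw [List.getD_eq_getElem _ _ h, List.take_concat_get']
  exact List.take_prefix _ _

/-- In `l`, before every letter `k + 1`, the letter `k` leads by more than `j`. -/
def LeadsBy (j : ℕ) (l : List ℕ) : Prop :=
  ∀ q k, (q ++ [k + 1]) <+: l → q.count (k + 1) + j < q.count k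

/-- In `l`, before every letter `k + 1`, the letter `k` leads by at most `j`. -/
def LeadsAtMost (j : ℕ) (l : List ℕ) : Prop :=
  ∀ q k, (q ++ [k + 1]) <+: l → q.count k ≤ q.count (k + 1) + j

/-- Distinct pairs of words with the same content, the first leading and the second not, give
distinct `1234`-avoiding permutations. -/
lemma card_mul_card_le {n j : ℕ} (U V : Finset (List ℕ))
    (hU : ∀ u ∈ U, u.length = n ∧ (∀ x ∈ u, x < 3) ∧ LeadsBy j u)
    (hV : ∀ v ∈ V, v.length = n ∧ LeadsAtMost j v)
    (hUV : ∀ u ∈ U, ∀ v ∈ V, u.Perm v) : U.card * V.card ≤ S n pattern1234 := by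
  classical
  have h : ∀ q ∈ U ×ˢ V, ∃ p : Equiv.Perm (Fin n), IsGreedy p (fun i => q.1.getD i 0) ∧
      ∀ i, q.2.getD (Fin.rev (p i)) 0 = q.1.getD i 0 := by
    intro q hq
    obtain ⟨h1, h2⟩ := mem_product.1 hq
    obtain ⟨hu, -, hu2⟩ := hU _ h1
    obtain ⟨hv, hv2⟩ := hV _ h2
    refine exists_isGreedy (fun i => q.1.getD i 0) (fun i => q.2.getD i 0) j ?_ ?_ ?_
    · intro k
      rw [card_filter_getD_eq hu, card_filter_getD_eq hv, (hUV _ h1 _ h2).count_eq]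
    · intro i k hk
      rw [← count_take_eq hu, ← count_take_eq hu]
      refine hu2 _ _ ?_
      rw [← hk]
      exact take_append_getD_prefix hu i
    · intro i k hk
      rw [← count_take_eq hv, ← count_take_eq hv]
      refine hv2 _ _ ?_
      rw [← hk]
      exact take_append_getD_prefix hv i
  choose! p hp1 hp2 using h
  rw [S, Nat.card_eq_fintype_card, Fintype.card_subtype, ← Finset.card_product]
  refine Finset.card_le_card_of_injOn p ?_ ?_
  · intro q hq
    have h1 := hU _ (mem_product.1 hq).1
    simp only [coe_filter, mem_univ, true_and, Set.mem_ofPred_eq]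
    refine (hp1 q hq).avoids fun i => ?_
    have h2 : (i : ℕ) < q.1.length := h1.1 ▸ i.2
    rw [List.getD_eq_getElem _ _ h2]
    exact h1.2.1 _ (List.getElem_mem h2)
  · intro q hq q' hq' he
    obtain ⟨h1, h2⟩ := mem_product.1 hq
    obtain ⟨h1', h2'⟩ := mem_product.1 hq'
    have h3 := hp1 q hq
    rw [he] at h3
    have h4 := h3.unique (hp1 q' hq')
    refine Prod.ext (eq_of_getD_eq (hU _ h1).1 (hU _ h1').1 fun i => congrFun h4 i)
      (eq_of_getD_eq (hV _ h2).1 (hV _ h2').1 fun i => ?_)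
    have h5 := hp2 q hq ((p q).symm (Fin.rev i))
    have h6 := hp2 q' hq' ((p q).symm (Fin.rev i))
    rw [← he] at h6
    rw [Equiv.apply_symm_apply, Fin.rev_rev] at h5 h6
    rw [h5, h6]
    exact congrFun h4 _

/-! ### Families of ternary words -/

/-- The words with `a` letters `0`, `b` letters `1` and `c` letters `2` are counted by the
trinomial coefficient. -/
lemma exists_words (n a b c : ℕ) (h : a + b + c = n) :
    ∃ F : Finset (List ℕ), (∀ l ∈ F, l.length = n ∧ (∀ x ∈ l, x < 3) ∧
      l.count 0 = a ∧ l.count 1 = b ∧ l.count 2 = c) ∧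
      F.card * (a.factorial * b.factorial * c.factorial) = n.factorial := by
  induction n generalizing a b c with
  | zero =>
    obtain ⟨rfl, rfl, rfl⟩ : a = 0 ∧ b = 0 ∧ c = 0 := by omega
    exact ⟨{[]}, by simp, by simp⟩
  | succ n ih =>
    have hA : ∃ F : Finset (List ℕ), (∀ l ∈ F, l.length = n ∧ (∀ x ∈ l, x < 3) ∧
        l.count 0 + 1 = a ∧ l.count 1 = b ∧ l.count 2 = c) ∧
        F.card * (a.factorial * b.factorial * c.factorial) = a * n.factorial := by
      rcases a with _ | a
      · exact ⟨∅, by simp, by simp⟩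
      · obtain ⟨F, h1, h2⟩ := ih a b c (by omega)
        refine ⟨F, fun l hl => ?_, ?_⟩
        · simpa using h1 l hl
        · rw [← h2, Nat.factorial_succ]
          ring
    have hB : ∃ F : Finset (List ℕ), (∀ l ∈ F, l.length = n ∧ (∀ x ∈ l, x < 3) ∧
        l.count 0 = a ∧ l.count 1 + 1 = b ∧ l.count 2 = c) ∧
        F.card * (a.factorial * b.factorial * c.factorial) = b * n.factorial := by
      rcases b with _ | b
      · exact ⟨∅, by simp, by simp⟩
      · obtain ⟨F, h1, h2⟩ := ih a b c (by omega)
        refine ⟨F, fun l hl => ?_, ?_⟩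
        · simpa using h1 l hl
        · rw [← h2, Nat.factorial_succ]
          ring
    have hC : ∃ F : Finset (List ℕ), (∀ l ∈ F, l.length = n ∧ (∀ x ∈ l, x < 3) ∧
        l.count 0 = a ∧ l.count 1 = b ∧ l.count 2 + 1 = c) ∧
        F.card * (a.factorial * b.factorial * c.factorial) = c * n.factorial := by
      rcases c with _ | c
      · exact ⟨∅, by simp, by simp⟩
      · obtain ⟨F, h1, h2⟩ := ih a b c (by omega)
        refine ⟨F, fun l hl => ?_, ?_⟩
        · simpa using h1 l hl
        · rw [← h2, Nat.factorial_succ]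
          ring
    obtain ⟨FA, hA1, hA2⟩ := hA
    obtain ⟨FB, hB1, hB2⟩ := hB
    obtain ⟨FC, hC1, hC2⟩ := hC
    have hinj : ∀ x : ℕ, Function.Injective (List.cons x) := fun x => List.cons_injective
    refine ⟨(FA.image (List.cons 0) ∪ FB.image (List.cons 1)) ∪ FC.image (List.cons 2), ?_, ?_⟩
    · intro l hl
      simp only [mem_union, mem_image] at hl
      rcases hl with (⟨l, hl, rfl⟩ | ⟨l, hl, rfl⟩) | ⟨l, hl, rfl⟩
      · have := hA1 l hl
        simpa using this
      · have := hB1 l hl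
        simpa using this
      · have := hC1 l hl
        simpa using this
    · rw [Finset.card_union_of_disjoint, Finset.card_union_of_disjoint,
        Finset.card_image_of_injective _ (hinj 0), Finset.card_image_of_injective _ (hinj 1),
        Finset.card_image_of_injective _ (hinj 2), add_mul, add_mul, hA2, hB2, hC2,
        Nat.factorial_succ, ← h]
      · ring
      · rw [Finset.disjoint_left]
        intro l h1 h2
        simp only [mem_image] at h1 h2
        obtain ⟨l, -, rfl⟩ := h1
        obtain ⟨l', -, h3⟩ := h2
        simp at h3
      · rw [Finset.disjoint_left]
        intro l h1 h2
        simp only [mem_image, mem_union] at h1 h2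
        obtain ⟨l', -, rfl⟩ := h2
        rcases h1 with ⟨l, -, h3⟩ | ⟨l, -, h3⟩ <;> simp at h3

/-- Concatenating blocks with `j` letters of each kind keeps all prefixes balanced up to `j`. -/
lemma exists_blocks {j : ℕ} {F : Finset (List ℕ)} (hF : ∀ l ∈ F, l.length = 3 * j ∧
    (∀ x ∈ l, x < 3) ∧ l.count 0 = j ∧ l.count 1 = j ∧ l.count 2 = j) (r : ℕ) :
    ∃ B : Finset (List ℕ), B.card = F.card ^ r ∧ ∀ l ∈ B, l.length = r * (3 * j) ∧
      (∀ x ∈ l, x < 3) ∧ (∀ k < 3, l.count k = r * j) ∧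
      ∀ q, q <+: l → ∀ k < 3, ∀ k' < 3, q.count k ≤ q.count k' + j := by
  have hF' : ∀ l ∈ F, ∀ k < 3, l.count k = j := by
    intro l hl k hk
    obtain ⟨-, -, h0, h1, h2⟩ := hF l hl
    interval_cases k <;> assumption
  induction r with
  | zero =>
    refine ⟨{[]}, by simp, ?_⟩
    intro l hl
    rw [mem_singleton] at hl
    subst hl
    simp
  | succ r ih =>
    obtain ⟨B, hB1, hB2⟩ := ih
    refine ⟨(F ×ˢ B).image fun q => q.1 ++ q.2, ?_, ?_⟩
    · rw [Finset.card_image_of_injOn, Finset.card_product, hB1, pow_succ']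
      rintro ⟨w, l⟩ h1 ⟨w', l'⟩ h2 he
      have h3 := List.append_inj he
        ((hF w (mem_product.1 h1).1).1.trans (hF w' (mem_product.1 h2).1).1.symm)
      exact Prod.ext h3.1 h3.2
    · intro l hl
      simp only [mem_image, mem_product, Prod.exists] at hl
      obtain ⟨w, l, ⟨hw, hl⟩, rfl⟩ := hl
      obtain ⟨h1, h2, h3, h4⟩ := hB2 l hl
      have hw' := hF w hw
      refine ⟨?_, ?_, ?_, ?_⟩
      · rw [List.length_append, h1, hw'.1]
        ring
      · intro x hx
        rcases List.mem_append.1 hx with hx | hx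
        · exact hw'.2.1 x hx
        · exact h2 x hx
      · intro k hk
        rw [List.count_append, hF' w hw k hk, h3 k hk]
        ring
      · rintro q ⟨t, ht⟩ k hk k' hk'
        rcases List.append_eq_append_iff.1 ht with ⟨s, hs, -⟩ | ⟨s, rfl, hs⟩
        · have h5 : q.count k ≤ w.count k := by
            rw [hs, List.count_append]
            omega
          rw [hF' w hw k hk] at h5
          omega
        · rw [List.count_append, List.count_append, hF' w hw k hk, hF' w hw k' hk']
          have := h4 s ⟨t, hs.symm⟩ k hk k' hk'
          omega

lemma concat_prefix_append {q X l : List ℕ} {a : ℕ} (h : (q ++ [a]) <+: (X ++ l)) :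
    (q ++ [a]) <+: X ∨ ∃ s, q = X ++ s ∧ (s ++ [a]) <+: l := by
  obtain ⟨t, ht⟩ := h
  rw [List.append_assoc] at ht
  rcases List.append_eq_append_iff.1 ht with ⟨s, hs, hs2⟩ | ⟨s, hs, hs2⟩
  · rcases s with _ | ⟨b, s⟩
    · exact Or.inr ⟨[], by simpa using hs.symm, ⟨t, by simpa using hs2⟩⟩
    · simp only [List.cons_append, List.cons.injEq] at hs2
      exact Or.inl ⟨s, by rw [hs, hs2.1]; simp⟩
  · exact Or.inr ⟨s, hs, ⟨t, by rw [hs2]; simp⟩⟩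

lemma of_concat_prefix_replicate {q : List ℕ} {a b m : ℕ}
    (h : (q ++ [a]) <+: List.replicate m b) : a = b ∧ ∃ m' < m, q = List.replicate m' b := by
  obtain ⟨h1, h2⟩ := List.prefix_replicate_iff.1 h
  have h3 : ∀ x ∈ q ++ [a], x = b := fun x hx => by
    rw [h2] at hx
    exact List.eq_of_mem_replicate hx
  refine ⟨h3 a (by simp), q.length, by simpa using h1, ?_⟩
  exact List.eq_replicate_iff.2 ⟨rfl, fun x hx => h3 x (by simp [hx])⟩

/-- The prefix gives letter `k` a head start of more than `2 j` over letter `k + 1`, of which a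
balanced word loses at most `j`. -/
lemma leadsBy_append {j x₀ x₁ : ℕ} {l : List ℕ} (h1 : 2 * j < x₁) (h0 : x₁ + 2 * j < x₀)
    (hl : ∀ x ∈ l, x < 3)
    (hq : ∀ q, q <+: l → ∀ k < 3, ∀ k' < 3, q.count k ≤ q.count k' + j) :
    LeadsBy j (List.replicate x₀ 0 ++ List.replicate x₁ 1 ++ l) := by
  intro q k h
  rcases concat_prefix_append h with hX | ⟨s, rfl, hs⟩
  · rcases concat_prefix_append hX with hX | ⟨s, rfl, hs⟩
    · have := (of_concat_prefix_replicate hX).1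
      omega
    · obtain ⟨h2, m, hm, rfl⟩ := of_concat_prefix_replicate hs
      obtain rfl : k = 0 := by omega
      simp [List.count_append, List.count_replicate]
      omega
  · have h2 : k + 1 < 3 := hl _ (hs.subset (by simp))
    have h3 := hq s ((List.prefix_append s [k + 1]).trans hs) (k + 1) h2 k (by omega)
    rw [List.count_append, List.count_append]
    have hk : k = 0 ∨ k = 1 := by omega
    rcases hk with rfl | rfl
    · simp [List.count_append, List.count_replicate] at h3 ⊢
      omega
    · simp [List.count_append, List.count_replicate] at h3 ⊢
      omega

/-- The letters `0` and `1` that compensate the head start are appended with the `1`s first, so that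
no letter `k + 1` is preceded by an excess of letters `k`. -/
lemma leadsAtMost_append {j m x₀ x₁ : ℕ} {l : List ℕ} (hl : ∀ x ∈ l, x < 3)
    (hm : ∀ k < 3, l.count k = m)
    (hq : ∀ q, q <+: l → ∀ k < 3, ∀ k' < 3, q.count k ≤ q.count k' + j) :
    LeadsAtMost j (l ++ (List.replicate x₁ 1 ++ List.replicate x₀ 0)) := by
  intro q k h
  rcases concat_prefix_append h with hq' | ⟨s, rfl, hs⟩
  · have h2 : k + 1 < 3 := hl _ (hq'.subset (by simp))
    exact hq q ((List.prefix_append q [k + 1]).trans hq') k (by omega) (k + 1) h2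
  · rcases concat_prefix_append hs with hY | ⟨s, rfl, hY⟩
    · obtain ⟨h2, m', -, rfl⟩ := of_concat_prefix_replicate hY
      obtain rfl : k = 0 := by omega
      rw [List.count_append, List.count_append, hm 0 (by omega), hm (0 + 1) (by omega)]
      simp [List.count_replicate]
      omega
    · have := (of_concat_prefix_replicate hY).1
      omega

/-- Both words are built from `r` freely chosen balanced blocks of `3 j` letters, together with the
head start and a padding by `e` letters, by which every length is reached. -/
lemma pow_le_card_avoids1234 {j : ℕ} {F : Finset (List ℕ)} (hF : ∀ l ∈ F, l.length = 3 * j ∧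
    (∀ x ∈ l, x < 3) ∧ l.count 0 = j ∧ l.count 1 = j ∧ l.count 2 = j) (r e : ℕ) :
    (F.card ^ 2) ^ r ≤ S (6 * j + 3 + e + r * (3 * j)) pattern1234 := by
  obtain ⟨B, hB1, hB2⟩ := exists_blocks hF r
  have h := card_mul_card_le (n := 6 * j + 3 + e + r * (3 * j)) (j := j)
    (B.image (List.replicate (4 * j + 2 + e) 0 ++ List.replicate (2 * j + 1) 1 ++ ·))
    (B.image (· ++ (List.replicate (2 * j + 1) 1 ++ List.replicate (4 * j + 2 + e) 0)))
    ?_ ?_ ?_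
  · rw [Finset.card_image_of_injective _ (List.append_right_injective _),
      Finset.card_image_of_injective _ (List.append_left_injective _), hB1, ← sq, ← pow_mul,
      mul_comm r 2, pow_mul] at h
    exact h
  · intro u hu
    obtain ⟨l, hl, rfl⟩ := mem_image.1 hu
    obtain ⟨h1, h2, h3, h4⟩ := hB2 l hl
    refine ⟨?_, ?_, leadsBy_append (by omega) (by omega) h2 h4⟩
    · simp only [List.length_append, List.length_replicate, h1]
      ring
    · intro x hx
      simp only [List.mem_append, List.mem_replicate] at hx
      rcases hx with (⟨-, rfl⟩ | ⟨-, rfl⟩) | hx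
      · omega
      · omega
      · exact h2 x hx
  · intro v hv
    obtain ⟨l, hl, rfl⟩ := mem_image.1 hv
    obtain ⟨h1, h2, h3, h4⟩ := hB2 l hl
    refine ⟨?_, leadsAtMost_append h2 h3 h4⟩
    simp only [List.length_append, List.length_replicate, h1]
    ring
  · intro u hu v hv
    obtain ⟨l, hl, rfl⟩ := mem_image.1 hu
    obtain ⟨l', hl', rfl⟩ := mem_image.1 hv
    obtain ⟨h1, h2, h3, -⟩ := hB2 l hl
    obtain ⟨h1', h2', h3', -⟩ := hB2 l' hl'
    have hp : l.Perm l' := by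
      rw [List.perm_iff_count]
      intro k
      by_cases hk : k < 3
      · rw [h3 k hk, h3' k hk]
      · rw [List.count_eq_zero_of_not_mem fun h => hk (h2 k h),
          List.count_eq_zero_of_not_mem fun h => hk (h2' k h)]
    exact (List.perm_append_comm.trans (hp.append List.perm_append_comm))

/-- The growth rate of the `1234`-avoiding permutations exceeds `8`; `81 / 10` is what balanced
blocks of `90` letters give. -/
lemma pow_le_mul_card_avoids1234 {n : ℕ} (hn : 183 ≤ n) :
    (81 / 10 : ℝ) ^ n ≤ (81 / 10) ^ 273 * S n pattern1234 := by
  obtain ⟨F, hF, hcard⟩ := exists_words 90 30 30 30 rfl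
  have hnum : (81 / 10 : ℝ) ^ 90 ≤ (F.card : ℝ) ^ 2 := by
    have h1 : (F.card : ℝ) = (Nat.factorial 90 : ℝ) / (Nat.factorial 30 : ℝ) ^ 3 := by
      rw [eq_div_iff (by positivity), ← hcard]
      push_cast
      ring
    rw [h1]
    norm_num [Nat.factorial]
  have h := pow_le_card_avoids1234 (j := 30) hF ((n - 183) / 90) ((n - 183) % 90)
  rw [show 6 * 30 + 3 + (n - 183) % 90 + (n - 183) / 90 * (3 * 30) = n by omega] at h
  have h2 : ((F.card : ℝ) ^ 2) ^ ((n - 183) / 90) ≤ S n pattern1234 := by exact_mod_cast h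
  calc (81 / 10 : ℝ) ^ n ≤ (81 / 10) ^ (273 + 90 * ((n - 183) / 90)) :=
        pow_le_pow_right₀ (by norm_num) (by omega)
    _ = (81 / 10) ^ 273 * ((81 / 10) ^ 90) ^ ((n - 183) / 90) := by rw [pow_add, pow_mul]
    _ ≤ (81 / 10) ^ 273 * S n pattern1234 := by
      refine mul_le_mul_of_nonneg_left (le_trans ?_ h2) (by positivity)
      exact pow_le_pow_left₀ (by positivity) hnum _

lemma card_avoids1234_pos (n : ℕ) : 0 < S n pattern1234 := by
  rw [S, Nat.card_pos_iff]
  refine ⟨⟨⟨Fin.revPerm, ?_⟩⟩, inferInstance⟩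
  rintro ⟨f, hf, hp⟩
  have h1 := (hp 0 1).1 (by decide)
  have h2 := hf (show (0 : Fin 4) < 1 by decide)
  rw [Fin.revPerm_apply, Fin.revPerm_apply, Fin.rev_lt_rev] at h1
  exact lt_asymm h1 h2

end PatternAvoidance

theorem mainTheorem7 :
    (∀ n : ℕ, 0 < PatternAvoidance.S n PatternAvoidance.pattern1234) ∧
    Filter.Tendsto
      (fun n : ℕ => (PatternAvoidance.S n PatternAvoidance.pattern1342 : ℝ) /
        (PatternAvoidance.S n PatternAvoidance.pattern1234 : ℝ))
      Filter.atTop (nhds 0) := by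
  refine ⟨PatternAvoidance.card_avoids1234_pos, ?_⟩
  obtain ⟨K, hK⟩ : ∃ K : ℝ, ∀ n ≥ 183, (81 / 10 : ℝ) ^ n ≤
      K * PatternAvoidance.S n PatternAvoidance.pattern1234 :=
    ⟨_, fun _ hn => PatternAvoidance.pow_le_mul_card_avoids1234 hn⟩
  have hlim : Filter.Tendsto (fun n : ℕ => 32 / 27 * K * (80 / 81 : ℝ) ^ n)
      Filter.atTop (nhds 0) := by
    simpa using (tendsto_pow_atTop_nhds_zero_of_lt_one (r := (80 / 81 : ℝ)) (by norm_num)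
      (by norm_num)).const_mul (32 / 27 * K)
  refine tendsto_of_tendsto_of_tendsto_of_le_of_le' tendsto_const_nhds hlim
    (Filter.Eventually.of_forall fun n => by positivity) ?_
  filter_upwards [Filter.eventually_ge_atTop 183] with n hn
  have hpos : (0 : ℝ) < PatternAvoidance.S n PatternAvoidance.pattern1234 := by
    exact_mod_cast PatternAvoidance.card_avoids1234_pos n
  rw [div_le_iff₀ hpos]
  calc (PatternAvoidance.S n PatternAvoidance.pattern1342 : ℝ)
      ≤ 32 / 27 * 8 ^ n := PatternAvoidance.card_avoids1342_le n
    _ = 32 / 27 * ((80 / 81) ^ n * (81 / 10) ^ n) := by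
      rw [← mul_pow]
      norm_num
    _ ≤ 32 / 27 * ((80 / 81) ^ n * (K * PatternAvoidance.S n PatternAvoidance.pattern1234)) := by
      gcongr
      exact hK n hn
    _ = _ := by ring
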